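/- **Setting.** A dg vertex operator algebra is a cochain complex $(V=\bigoplus_{p\in\mathbb Z}V^{[p]},d)$ of complex vector spaces with a vertex operator map $Y(u,x)=\sum_{n\in\mathbb Z}u_nx^{-n-1}$ that is a chain map when $x$ is given cohomological degree $-2$ (so $|u_nv|=|u|+|v|-2n-2$ and $d(u_nv)=(du)_nv+(-1)^{|u|}u_n(dv)$), and with a vacuum $\mathbf 1\in V^{[0]}$, $d\mathbf 1=0$, satisfying truncation, the vacuum and creation axioms, and the Jacobi identity with Koszul signs. It also has a conformal vector $\omega\in V^{[4]}$, $d\omega=0$, with $L(n)=\omega_{n+1}$, such that the $L(n)$ satisfy the Virasoro relations for some central charge $c\in\mathbb C$, $V=\bigoplus_{n\in\frac12\mathbb Z}V_n$ with $V_n=\ker(L(0)-n)$ finite-dimensional and $V_n=0$ for $n\ll0$, $\omega\in V_2$, and $L(-1)v=v_{-2}\mathbf 1$ for all $v$. For $u$ of weight $\mathrm{wt}(u)$ and $v\in V$ put $$u\ast v=\sum_{i\ge0}\binom{\mathrm{wt}(u)}{i}u_{i-1}v,\qquad u\circ v=\sum_{i\ge0}\binom{\mathrm{wt}(u)}{i}u_{i-2}v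 .$$ Let $O(V)$ be the span of all $u\circ v$, let $A(V)=V/O(V)$ (the Zhu algebra), and write $[v]$ for the class of $v$. Let $F^pA(V)$ be the image of $\bigoplus_{q\le p}V^{[q]}$ ($p\in\mathbb Z$) and $W_nA(V)$ the image of $\bigoplus_{m\le n}V_m$ ($n\in\frac12\mathbb Z$). Write $A=A(V)$. Put $\mathrm{gr}^{[p]}A=F^pA/F^{p-1}A$, filtered by the images of $F^pA\cap W_nA$, and $\mathrm{gr}_nA=W_nA/W_{n-1/2}A$, filtered by the images of $F^pA\cap W_nA$. Let $\mathrm{gr}_*\mathrm{gr}^{[*]}A$ and $\mathrm{gr}^{[*]}\mathrm{gr}_*A$ be the direct sums, over all $(p,n)\in\mathbb Z\times\frac12\mathbb Z$, of the successive quotients of these induced filtrations. Each element of $F^pA\cap W_nA$ has a class of degree $p$ and weight $n$ in both of them. **Proposition.** Let $V$ be a dg vertex operator algebra. The operation $\ast$ induces on $A(V)$ an associative product with unit $[\mathbf 1]$, and $d$ induces a linear map $d$ on $A(V)$, such that $F^pA\ast F^qA\subseteq F^{p+q}A$, $W_mA\ast W_nA\subseteq W_{m+n}A$, $d(F^pA)\subseteq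 F^{p+1}A$ and $d(W_nA)\subseteq W_nA$. The product, the unit and $d$ induce operations on classes in $\mathrm{gr}_*\mathrm{gr}^{[*]}A$ and in $\mathrm{gr}^{[*]}\mathrm{gr}_*A$. In each of these two spaces there is a well-defined bilinear bracket such that, for $u\in V^{[p]}_m$ and $v\in V^{[q]}_n$, the bracket of the class of $[u]$ in degree $p$ and weight $m$ with the class of $[v]$ in degree $q$ and weight $n$ is the class of $$[u]\ast[v]-(-1)^{pq}[v]\ast[u]\in F^{p+q-2}A\cap W_{m+n-1}A$$ in degree $p+q-2$ and weight $m+n-1$. With these operations each of the two spaces is a weight-graded dg Poisson algebra: it is a $\mathbb Z\times\frac12\mathbb Z$-graded associative unital algebra with a square-zero derivation $d$ of degree $1$ and weight $0$, and, for homogeneous $x$, $y$ and all $z$, - $\{x,y\}=-(-1)^{|x||y|}\{y,x\}$, - $\{x,\{y,z\}\}=\{\{x,y\},z\}+(-1)^{|x||y|}\{y,\{x,z\}\}$, - $\{x,yz\}=\{x,y\}z+(-1)^{|x||y|}y\{x,z\}$, - $d\{x,y\}=\{dx,y\}+(-1)^{|x|}\{x,dy\}$. The bracket has cohomological degree $-2$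 and weight degree $-1$, and the product is graded commutative: $xy=(-1)^{|x||y|}yx$. Moreover there is an isomorphism of weight-graded dg Poisson algebras $$\mathrm{gr}_*\mathrm{gr}^{[*]}A(V)\;\cong\;\mathrm{gr}^{[*]}\mathrm{gr}_*A(V)$$ that sends the class of each $x\in F^pA\cap W_nA$ to the class of $x$ of the same degree and weight. -/

import Mathlib

open scoped DirectSum

universe u

namespace DGVertex

/-- The sign `(-1)^k`. -/
noncomputable def sgn (k : ℤ) : ℂ := (-1 : ℂ) ^ k

/-! ### Vertex operator algebras in cochain complexes -/

/-- A dg vertex operator algebra with underlying complex vector space `V`.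
`mode n u v` is `u_n v`, where `Y(u, x) = ∑ u_n x^(-n-1)` and `x` has cohomological degree `-2`.
The Virasoro operators are `L(n) = ω_(n+1)`. -/
structure DGVertexOperatorAlgebra (V : Type u) [AddCommGroup V] [Module ℂ V] where
  /-- `deg p` is the component of cohomological degree `p`. -/
  deg : ℤ → Submodule ℂ V
  deg_internal : DirectSum.IsInternal deg
  /-- the differential -/
  d : V →ₗ[ℂ] V
  d_deg : ∀ p : ℤ, ∀ v ∈ deg p, d v ∈ deg (p + 1)
  d_d : ∀ v : V, d (d v) = 0
  mode : ℤ → V →ₗ[ℂ] V →ₗ[ℂ] V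
  /-- `Y` preserves degree, where `x` has degree `-2`. -/
  mode_deg : ∀ n p q : ℤ, ∀ u ∈ deg p, ∀ v ∈ deg q, mode n u v ∈ deg (p + q - 2 * n - 2)
  /-- `Y` is compatible with the differentials. -/
  d_mode : ∀ n p : ℤ, ∀ u ∈ deg p, ∀ v : V,
    d (mode n u v) = mode n (d u) v + sgn p • mode n u (d v)
  /-- the vacuum vector -/
  vac : V
  vac_deg : vac ∈ deg 0
  d_vac : d vac = 0
  truncation : ∀ u v : V, ∃ N : ℤ, ∀ n : ℤ, N ≤ n → mode n u v = 0
  vacuum : ∀ (n : ℤ) (v : V), mode n vac v = if n = -1 then v else 0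
  creation : ∀ (n : ℤ) (v : V), 0 ≤ n → mode n v vac = 0
  creation_neg_one : ∀ v : V, mode (-1) v vac = v
  /-- The Jacobi identity, coefficient by coefficient. All sums are finite by `truncation`. -/
  jacobi : ∀ (l m n p q : ℤ), ∀ u ∈ deg p, ∀ v ∈ deg q, ∀ w : V,
    (∑ᶠ i : ℕ, ((-1 : ℂ) ^ i * ((Ring.choose l i : ℤ) : ℂ)) •
      (mode (m + l - i) u (mode (n + i) v w)
        - (sgn l * sgn (p * q)) • mode (n + l - i) v (mode (m + i) u w)))
      = ∑ᶠ i : ℕ, ((Ring.choose m i : ℤ) : ℂ) • mode (m + n - i) (mode (l + i) u v) w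
  /-- the conformal vector -/
  conf : V
  conf_deg : conf ∈ deg 4
  d_conf : d conf = 0
  centralCharge : ℂ
  virasoro : ∀ (m n : ℤ) (v : V),
    mode (m + 1) conf (mode (n + 1) conf v) - mode (n + 1) conf (mode (m + 1) conf v)
      = ((m : ℂ) - n) • mode (m + n + 1) conf v
        + (if m + n = 0 then ((m : ℂ) ^ 3 - m) / 12 * centralCharge else 0) • v
  /-- `V` is the direct sum of the `L(0)`-eigenspaces for the eigenvalues in `½ℤ`. -/
  wt_internal : DirectSum.IsInternal fun k : ℤ =>
    Module.End.eigenspace (mode 1 conf) ((k : ℂ) / 2)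
  wt_finite : ∀ k : ℤ, Module.Finite ℂ (Module.End.eigenspace (mode 1 conf) ((k : ℂ) / 2))
  wt_bounded : ∃ N : ℤ, ∀ k : ℤ, k < N → Module.End.eigenspace (mode 1 conf) ((k : ℂ) / 2) = ⊥
  conf_wt : mode 1 conf conf = (2 : ℂ) • conf
  /-- `L(-1)` is the translation operator `v ↦ v_(-2) 1`. -/
  translation : ∀ v : V, mode 0 conf v = mode (-2) v vac

/-! ### Associated graded spaces -/

section Graded

variable {M : Type u} [AddCommGroup M] [Module ℂ M]

/-- The component `G_i / G_(i-1)` of the associated graded space of an increasing filtration. -/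
abbrev Gr (G : ℤ → Submodule ℂ M) (i : ℤ) : Type u :=
  ↥(G i) ⧸ (G (i - 1)).submoduleOf (G i)

instance Gr.addCommGroup (G : ℤ → Submodule ℂ M) (i : ℤ) : AddCommGroup (Gr G i) :=
  Submodule.Quotient.addCommGroup _

instance Gr.module (G : ℤ → Submodule ℂ M) (i : ℤ) : Module ℂ (Gr G i) :=
  Submodule.Quotient.module _

/-- The filtration that `G` induces on `F_p / F_(p-1)`: the images of the `F_p ∩ G_n`. -/
def inducedFil (F G : ℤ → Submodule ℂ M) (p : ℤ) : ℤ → Submodule ℂ (Gr F p) := fun n =>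
  ((G n).submoduleOf (F p)).map ((F (p - 1)).submoduleOf (F p)).mkQ

/-- The associated graded space first of `F`, then of the filtration induced by `G`:
the sum over `(p, n)` of the components of index `n` of `gr^G (F_p / F_(p-1))`. -/
def GrGr (F G : ℤ → Submodule ℂ M) : Type u :=
  ⨁ i : ℤ × ℤ, Gr (inducedFil F G i.1) i.2

noncomputable instance GrGr.addCommGroup (F G : ℤ → Submodule ℂ M) : AddCommGroup (GrGr F G) :=
  inferInstanceAs (AddCommGroup (⨁ i : ℤ × ℤ, Gr (inducedFil F G i.1) i.2))

noncomputable instance GrGr.module (F G : ℤ → Submodule ℂ M) : Module ℂ (GrGr F G) :=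
  inferInstanceAs (Module ℂ (⨁ i : ℤ × ℤ, Gr (inducedFil F G i.1) i.2))

/-- The inclusion of the component of index `(p, n)`. -/
noncomputable def GrGr.incl (F G : ℤ → Submodule ℂ M) (p n : ℤ) :
    Gr (inducedFil F G p) n →ₗ[ℂ] GrGr F G :=
  DirectSum.lof ℂ (ℤ × ℤ) (fun i => Gr (inducedFil F G i.1) i.2) (p, n)

/-- The homogeneous component of index `(p, n)` of `GrGr F G`. -/
noncomputable def GrGr.piece (F G : ℤ → Submodule ℂ M) (p n : ℤ) : Submodule ℂ (GrGr F G) :=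
  LinearMap.range (GrGr.incl F G p n)

/-- The image of `x ∈ F_p ∩ G_n` in `F_p / F_(p-1)`, as an element of the induced filtration. -/
def toInducedFil (F G : ℤ → Submodule ℂ M) (p n : ℤ) (x : M) (hF : x ∈ F p) (hG : x ∈ G n) :
    ↥(inducedFil F G p n) :=
  ⟨Submodule.Quotient.mk ⟨x, hF⟩, Submodule.mem_map.mpr ⟨⟨x, hF⟩, hG, rfl⟩⟩

/-- The class in the component of index `(p, n)` of an element of `F_p ∩ G_n`. -/
noncomputable def GrGr.symbol (F G : ℤ → Submodule ℂ M) (p n : ℤ) (x : M) (hF : x ∈ F p) (hG : x ∈ G n) :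
    GrGr F G :=
  GrGr.incl F G p n (Submodule.Quotient.mk (toInducedFil F G p n x hF hG))

end Graded

/-! ### Weight graded dg Poisson algebras -/

/-- A (not necessarily commutative) weight graded dg Poisson algebra structure on a bigraded vector
space: `gr p k` is the component of cohomological degree `p` and weight `k / 2`, and the bracket
has cohomological degree `a` and weight `b / 2`. -/
structure WeightGradedDGPoisson {B : Type u} [AddCommGroup B] [Module ℂ B]
    (gr : ℤ → ℤ → Submodule ℂ B) (a b : ℤ) where
  internal : DirectSum.IsInternal fun i : ℤ × ℤ => gr i.1 i.2
  mul : B →ₗ[ℂ] B →ₗ[ℂ] B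
  one : B
  d : B →ₗ[ℂ] B
  bracket : B →ₗ[ℂ] B →ₗ[ℂ] B
  one_mem : one ∈ gr 0 0
  mul_mem : ∀ p k q l : ℤ, ∀ x ∈ gr p k, ∀ y ∈ gr q l, mul x y ∈ gr (p + q) (k + l)
  mul_assoc : ∀ x y z : B, mul (mul x y) z = mul x (mul y z)
  one_mul : ∀ x : B, mul one x = x
  mul_one : ∀ x : B, mul x one = x
  d_mem : ∀ p k : ℤ, ∀ x ∈ gr p k, d x ∈ gr (p + 1) k
  d_d : ∀ x : B, d (d x) = 0
  d_mul : ∀ p k : ℤ, ∀ x ∈ gr p k, ∀ y : B, d (mul x y) = mul (d x) y + sgn p • mul x (d y)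
  bracket_mem : ∀ p k q l : ℤ, ∀ x ∈ gr p k, ∀ y ∈ gr q l,
    bracket x y ∈ gr (p + q + a) (k + l + b)
  bracket_skew : ∀ p k q l : ℤ, ∀ x ∈ gr p k, ∀ y ∈ gr q l,
    bracket x y = -(sgn ((p + a) * (q + a)) • bracket y x)
  bracket_jacobi : ∀ p k q l : ℤ, ∀ x ∈ gr p k, ∀ y ∈ gr q l, ∀ z : B,
    bracket x (bracket y z)
      = bracket (bracket x y) z + sgn ((p + a) * (q + a)) • bracket y (bracket x z)
  bracket_mul : ∀ p k q l : ℤ, ∀ x ∈ gr p k, ∀ y ∈ gr q l, ∀ z : B,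
    bracket x (mul y z) = mul (bracket x y) z + sgn ((p + a) * q) • mul y (bracket x z)
  d_bracket : ∀ p k : ℤ, ∀ x ∈ gr p k, ∀ y : B,
    d (bracket x y) = sgn a • bracket (d x) y + sgn (p + a) • bracket x (d y)

/-- The product is graded commutative with respect to the cohomological degree. -/
def WeightGradedDGPoisson.GradedCommutative {B : Type u} [AddCommGroup B] [Module ℂ B]
    {gr : ℤ → ℤ → Submodule ℂ B} {a b : ℤ} (P : WeightGradedDGPoisson gr a b) : Prop :=
  ∀ p k q l : ℤ, ∀ x ∈ gr p k, ∀ y ∈ gr q l, P.mul x y = sgn (p * q) • P.mul y x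

/-- A linear isomorphism is an isomorphism of weight graded dg Poisson algebras. -/
structure IsPoissonIso {B C : Type u} [AddCommGroup B] [Module ℂ B] [AddCommGroup C] [Module ℂ C]
    {gr : ℤ → ℤ → Submodule ℂ B} {gr' : ℤ → ℤ → Submodule ℂ C} {a b : ℤ}
    (P : WeightGradedDGPoisson gr a b) (Q : WeightGradedDGPoisson gr' a b) (e : B ≃ₗ[ℂ] C) :
    Prop where
  map_gr : ∀ p k : ℤ, (gr p k).map (e : B →ₗ[ℂ] C) = gr' p k
  map_one : e P.one = Q.one
  map_mul : ∀ x y : B, e (P.mul x y) = Q.mul (e x) (e y)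
  map_d : ∀ x : B, e (P.d x) = Q.d (e x)
  map_bracket : ∀ x y : B, e (P.bracket x y) = Q.bracket (e x) (e y)

/-! ### The Zhu algebra -/

section Zhu

variable {V : Type u} [AddCommGroup V] [Module ℂ V] (X : DGVertexOperatorAlgebra V)

/-- The space of vectors of weight `k / 2`, an eigenspace of `L(0) = ω_1`. -/
noncomputable def wtSpace (k : ℤ) : Submodule ℂ V :=
  Module.End.eigenspace (X.mode 1 X.conf) ((k : ℂ) / 2)

/-- The product `u ∗ v = ∑ binom(wt u, i) u_(i-1) v` for `u` of weight `k / 2`. The sum is finite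
by truncation. -/
noncomputable def star (k : ℤ) (u v : V) : V :=
  ∑ᶠ i : ℕ, ((Ring.choose ((k : ℚ) / 2) i : ℚ) : ℂ) • X.mode ((i : ℤ) - 1) u v

/-- The element `u ∘ v = ∑ binom(wt u, i) u_(i-2) v` for `u` of weight `k / 2`. -/
noncomputable def circ (k : ℤ) (u v : V) : V :=
  ∑ᶠ i : ℕ, ((Ring.choose ((k : ℚ) / 2) i : ℚ) : ℂ) • X.mode ((i : ℤ) - 2) u v

/-- The subspace `O(V)` spanned by the `u ∘ v` with `u` homogeneous for the weight. -/
noncomputable def zhuO : Submodule ℂ V :=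
  Submodule.span ℂ {w | ∃ k : ℤ, ∃ u ∈ wtSpace X k, ∃ v : V, w = circ X k u v}

/-- The underlying vector space of the Zhu algebra `A(V) = V / O(V)`. -/
abbrev ZhuA : Type u := V ⧸ zhuO X

/-- The class `[v]` in `A(V)`. -/
noncomputable def cls (v : V) : ZhuA X := (zhuO X).mkQ v

/-- `F^p A(V)`: the image of the vectors of cohomological degree at most `p`. -/
noncomputable def filF (p : ℤ) : Submodule ℂ (ZhuA X) :=
  (⨆ q : ℤ, ⨆ _ : q ≤ p, X.deg q).map (zhuO X).mkQ

/-- The weight filtration of `A(V)`: the image of the vectors of weight at most `k / 2`.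
As the index runs through the doubled weights, the step that precedes `k` is `k - 1`. -/
noncomputable def filW (k : ℤ) : Submodule ℂ (ZhuA X) :=
  (⨆ j : ℤ, ⨆ _ : j ≤ k, wtSpace X j).map (zhuO X).mkQ

/-- The algebra structure and the differential of the Zhu algebra. `mul_cls` and `d_cls`
determine both maps, so there is at most one such structure. -/
structure ZhuStructure where
  mul : ZhuA X →ₗ[ℂ] ZhuA X →ₗ[ℂ] ZhuA X
  d : ZhuA X →ₗ[ℂ] ZhuA X
  mul_cls : ∀ k : ℤ, ∀ u ∈ wtSpace X k, ∀ v : V, mul (cls X u) (cls X v) = cls X (star X k u v)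
  d_cls : ∀ v : V, d (cls X v) = cls X (X.d v)
  mul_assoc : ∀ x y z : ZhuA X, mul (mul x y) z = mul x (mul y z)
  one_mul : ∀ x : ZhuA X, mul (cls X X.vac) x = x
  mul_one : ∀ x : ZhuA X, mul x (cls X X.vac) = x
  mul_filF : ∀ p q : ℤ, ∀ x ∈ filF X p, ∀ y ∈ filF X q, mul x y ∈ filF X (p + q)
  mul_filW : ∀ k l : ℤ, ∀ x ∈ filW X k, ∀ y ∈ filW X l, mul x y ∈ filW X (k + l)
  d_filF : ∀ p : ℤ, ∀ x ∈ filF X p, d x ∈ filF X (p + 1)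
  d_filW : ∀ k : ℤ, ∀ x ∈ filW X k, d x ∈ filW X k

/-- The component of cohomological degree `p` and weight `k / 2` of `gr_* gr^[*] A(V)`. -/
noncomputable def pieceWF (p k : ℤ) : Submodule ℂ (GrGr (filF X) (filW X)) :=
  GrGr.piece (filF X) (filW X) p k

/-- The component of cohomological degree `p` and weight `k / 2` of `gr^[*] gr_* A(V)`. -/
noncomputable def pieceFW (p k : ℤ) : Submodule ℂ (GrGr (filW X) (filF X)) :=
  GrGr.piece (filW X) (filF X) k p

/-- The class in `gr_* gr^[*] A(V)`, in degree `p` and weight `k / 2`. -/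
noncomputable def symbolWF (p k : ℤ) (x : ZhuA X) (hF : x ∈ filF X p) (hW : x ∈ filW X k) :
    GrGr (filF X) (filW X) :=
  GrGr.symbol (filF X) (filW X) p k x hF hW

/-- The class in `gr^[*] gr_* A(V)`, in degree `p` and weight `k / 2`. -/
noncomputable def symbolFW (p k : ℤ) (x : ZhuA X) (hF : x ∈ filF X p) (hW : x ∈ filW X k) :
    GrGr (filW X) (filF X) :=
  GrGr.symbol (filW X) (filF X) k p x hW hF

variable {X}

/-- The operations of `P` are those that the Zhu algebra induces on a doubly graded space, where
`σ p k` sends an element of `F^p ∩ W_k` to its class of degree `p` and weight `k / 2`. The bracket of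
the classes of `u` and `v`, both homogeneous for degree and weight, is the class of
`[u] ∗ [v] - (-1)^(|u| |v|) [v] ∗ [u]`, in degree `|u| + |v| - 2` and weight `wt u + wt v - 1`. -/
structure IsInduced (Z : ZhuStructure X) {B : Type u} [AddCommGroup B] [Module ℂ B]
    {gr : ℤ → ℤ → Submodule ℂ B}
    (σ : ∀ (p k : ℤ) (x : ZhuA X), x ∈ filF X p → x ∈ filW X k → B)
    (P : WeightGradedDGPoisson gr (-2) (-2)) : Prop where
  one_eq : ∃ (hF : cls X X.vac ∈ filF X 0) (hW : cls X X.vac ∈ filW X 0),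
    P.one = σ 0 0 (cls X X.vac) hF hW
  mul_eq : ∀ (p k q l : ℤ) (x y : ZhuA X) (hxF : x ∈ filF X p) (hxW : x ∈ filW X k)
    (hyF : y ∈ filF X q) (hyW : y ∈ filW X l),
    P.mul (σ p k x hxF hxW) (σ q l y hyF hyW)
      = σ (p + q) (k + l) (Z.mul x y) (Z.mul_filF p q x hxF y hyF) (Z.mul_filW k l x hxW y hyW)
  d_eq : ∀ (p k : ℤ) (x : ZhuA X) (hF : x ∈ filF X p) (hW : x ∈ filW X k),
    P.d (σ p k x hF hW) = σ (p + 1) k (Z.d x) (Z.d_filF p x hF) (Z.d_filW k x hW)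
  bracket_eq : ∀ p k q l : ℤ, ∀ u ∈ X.deg p ⊓ wtSpace X k, ∀ v ∈ X.deg q ⊓ wtSpace X l,
    ∃ (huF : cls X u ∈ filF X p) (huW : cls X u ∈ filW X k)
      (hvF : cls X v ∈ filF X q) (hvW : cls X v ∈ filW X l)
      (hF : Z.mul (cls X u) (cls X v) - sgn (p * q) • Z.mul (cls X v) (cls X u)
        ∈ filF X (p + q - 2))
      (hW : Z.mul (cls X u) (cls X v) - sgn (p * q) • Z.mul (cls X v) (cls X u)
        ∈ filW X (k + l - 2)),
      P.bracket (σ p k (cls X u) huF huW) (σ q l (cls X v) hvF hvW)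
        = σ (p + q - 2) (k + l - 2) _ hF hW

end Zhu

end DGVertex

/-! Write u[n] for `zmode X n u`, the coefficient of x^(-n-1) in (1 + x)^(wt u) Y(u, x). Then u ∗ v
= u[-1]v and u ∘ v = u[-2]v. Multiplying the Jacobi identity by (1 + x₁)^(wt u) (1 + x₂)^(wt v) and
expanding 1 + x₁ = (1 + x₂) + x₀ yields a Jacobi identity among the u[n] alone (`zmode_jacobi`). Its
only distortion is an extra factor (1 + x₂)^(l+t+1) next to u[l+t]v.

Zhu's theory follows by specialisation. First, u[n]v lies in O(V) for all n ≤ -2 (`zmode_mem_zhuO`),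
so a term whose outermost mode has index at most -2 is invisible in A(V). With this, O(V) is a
two-sided ideal, ∗ is associative on the quotient, and u ∗ v - (-1)^(pq) v ∗ u is congruent to the
sum of (-1)^t u[t]v over t ≥ 0 (`zmode_neg_one_comm`).

The mode u_n shifts the degree and the doubled weight by the same amount -2n-2, and u[n]v only
involves u_(n+i)v with i ≥ 0. So on A(V) both gradings become filtrations, the product respects
them, and the supercommutator lowers both by two. Since the degrees in u[n]v differ by even numbers,
the parity of the degree does survive on A(V). This makes A(V) a superalgebra with an odd
differential (`FilteredSuperalgebra`). In it the Poisson identities hold exactly for elements of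
definite parity, and every class has such a representative (`exists_symbol_par`), so they pass to
the doubly graded space. Graded commutativity holds because the supercommutator drops below F^(p+q).

The class of x in bidegree (p, n) vanishes if and only if x is a sum of elements of F_p ∩ G_(n-1)
and F_(p-1) ∩ G_n. This condition is symmetric in the two filtrations (Zassenhaus), so the two
iterated graded spaces are identified by matching classes (`exists_swap`), and the second Poisson
structure is the transport of the first. -/

namespace DGVertex

/-! ### Binomial coefficients -/

/-- The binomial coefficient of a rational number, as a complex number. -/
noncomputable def bin (r : ℚ) (i : ℕ) : ℂ := ((Ring.choose r i : ℚ) : ℂ)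

theorem bin_intCast (l : ℤ) (i : ℕ) : ((Ring.choose l i : ℤ) : ℂ) = bin (l : ℚ) i := by
  have h := Ring.map_choose (Int.castRingHom ℚ) l i
  simp only [eq_intCast] at h
  simp [bin, ← h]

theorem bin_natCast (k i : ℕ) : bin (k : ℚ) i = (k.choose i : ℂ) := by
  simp [bin, Ring.choose_natCast]

theorem bin_zero_right (r : ℚ) : bin r 0 = 1 := by
  simp [bin]

theorem bin_zero_left (i : ℕ) : bin 0 i = if i = 0 then 1 else 0 := by
  unfold bin
  rw [Ring.choose_zero_ite]
  split_ifs <;> simp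

theorem bin_neg_one (i : ℕ) : bin (-1) i = (-1) ^ i := by
  unfold bin
  rw [Ring.choose_neg]
  have : (1 : ℚ) + i - 1 = ((i : ℕ) : ℚ) := by ring
  rw [this, Ring.choose_natCast]
  simp [Int.negOnePow, Units.smul_def]

theorem bin_neg_two (i : ℕ) : bin (-2) i = (-1) ^ i * (i + 1) := by
  unfold bin
  rw [Ring.choose_neg]
  have : (2 : ℚ) + i - 1 = ((i + 1 : ℕ) : ℚ) := by push_cast; ring
  rw [this, Ring.choose_natCast]
  simp [Int.negOnePow, Units.smul_def, mul_add]

theorem bin_add (r s : ℚ) (j : ℕ) :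
    bin (r + s) j = ∑ p ∈ Finset.HasAntidiagonal.antidiagonal j, bin r p.1 * bin s p.2 := by
  simp [bin, Ring.add_choose_eq j (Commute.all r s)]

/-- Trinomial revision. The second factor is an ordinary binomial coefficient, written with `bin` so
that it matches the output of Vandermonde's identity. -/
theorem bin_mul_choose (r : ℚ) (g a : ℕ) :
    bin r (g + a) * bin ((g + a : ℕ) : ℚ) g = bin r g * bin (r - g) a := by
  have h := Ring.choose_add_smul_choose (r - g) a g
  rw [nsmul_eq_mul, sub_add_cancel] at h
  have h' : bin r (a + g) * ((a + g).choose g : ℂ) = bin r g * bin (r - g) a := by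
    unfold bin
    rw [mul_comm]
    exact_mod_cast congrArg (fun q : ℚ => (q : ℂ)) h
  rw [bin_natCast, add_comm g a, h']

/-! ### Double sums -/

section Sums

variable {V : Type u} [AddCommGroup V]

/-- The square and the triangle differ only in terms with i + j ≥ N, which vanish. -/
theorem sum_range_eq_sum_antidiagonal (N : ℕ) (g : ℕ → ℕ → V)
    (hg : ∀ i j, N ≤ i + j → g i j = 0) :
    ∑ i ∈ Finset.range N, ∑ j ∈ Finset.range N, g i j
      = ∑ k ∈ Finset.range N, ∑ p ∈ Finset.HasAntidiagonal.antidiagonal k, g p.1 p.2 := by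
  rw [← Finset.sum_product', Finset.sum_sigma']
  symm
  apply Finset.sum_bij_ne_zero (fun x _ _ => x.2)
  · rintro ⟨k, i, j⟩ h _
    simp only [Finset.mem_sigma, Finset.mem_range, Finset.HasAntidiagonal.mem_antidiagonal] at h
    simp only [Finset.mem_product, Finset.mem_range]
    omega
  · rintro ⟨k, p⟩ h _ ⟨k', p'⟩ h' _ e
    simp only [Finset.mem_sigma, Finset.mem_range, Finset.HasAntidiagonal.mem_antidiagonal] at h h' e
    subst e
    obtain rfl : k = k' := by rw [← h.2, ← h'.2]
    rfl
  · rintro ⟨i, j⟩ _ hne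
    have hlt : i + j < N := by
      by_contra hc
      exact hne (hg i j (not_lt.mp hc))
    exact ⟨⟨i + j, i, j⟩, by simp [hlt], hne, rfl⟩
  · rintro ⟨k, p⟩ _ _
    rfl

variable [Module ℂ V]

theorem sum_range_shift (N g : ℕ) (f : ℕ → ℂ) (X : ℕ → V) (hX : ∀ j, N ≤ j → X j = 0) :
    ∑ k ∈ Finset.range N, f k • X (g + k)
      = ∑ j ∈ Finset.range N, (if g ≤ j then f (j - g) else 0) • X j := by
  apply Finset.sum_bij_ne_zero (fun k _ _ => g + k)
  · intro k _ hne
    rw [Finset.mem_range]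
    by_contra hc
    exact hne (by rw [hX _ (not_lt.mp hc), smul_zero])
  · intro k _ _ k' _ _ e
    exact Nat.add_left_cancel e
  · intro j hj hne
    by_cases h : g ≤ j
    · refine ⟨j - g, by rw [Finset.mem_range] at *; omega, ?_, by omega⟩
      simpa [h, Nat.add_sub_cancel' h] using hne
    · simp [h] at hne
  · intro k _ _
    simp

/-- Both sides are the coefficient of x₀^i x₂^(m+j-i) in x₁^m (1 + x₁)^r (1 + x₂)^s with x₁ = x₂ +
x₀. On the left, (1 + x₁)^r is expanded in powers of x₁. On the right, it is expanded as ((1 + x₂) +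
x₀)^r, which leaves (1 + x₂)^(r+s-g) next to x₀^g. -/
theorem sum_bin_mul_bin (m r s : ℚ) (i j : ℕ) :
    ∑ p ∈ Finset.HasAntidiagonal.antidiagonal j, bin r p.1 * bin s p.2 * bin (m + p.1) i
      = ∑ q ∈ Finset.HasAntidiagonal.antidiagonal i, bin m q.1 * bin r q.2 *
          (if q.2 ≤ j then bin (r + s - q.2) (j - q.2) else 0) := by
  simp only [bin_add m, Finset.mul_sum]
  rw [Finset.sum_comm]
  refine Finset.sum_congr rfl fun q _ => ?_
  split_ifs with h
  · obtain ⟨k, rfl⟩ := Nat.exists_eq_add_of_le h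
    rw [Nat.add_sub_cancel_left, show r + s - (q.2 : ℚ) = (r - q.2) + s by ring, bin_add,
      Finset.mul_sum]
    symm
    apply Finset.sum_bij_ne_zero (fun p _ _ => (q.2 + p.1, p.2))
    · rintro ⟨a, b⟩ hp _
      simp only [Finset.HasAntidiagonal.mem_antidiagonal] at *
      omega
    · rintro ⟨a, b⟩ _ _ ⟨a', b'⟩ _ _ e
      simp only [Prod.mk.injEq] at *
      omega
    · rintro ⟨a, b⟩ hp hne
      simp only [Finset.HasAntidiagonal.mem_antidiagonal] at hp
      -- Here `a` is a natural number, so the factor `bin a q.2` vanishes for a < q.2 and only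
      -- shifted indices contribute.
      have hle : q.2 ≤ a := by
        by_contra hc
        apply hne
        rw [bin_natCast a, Nat.choose_eq_zero_of_lt (not_le.mp hc)]
        simp
      obtain ⟨c, rfl⟩ := Nat.exists_eq_add_of_le hle
      refine ⟨(c, b), by simp only [Finset.HasAntidiagonal.mem_antidiagonal]; omega, ?_, rfl⟩
      intro h0
      apply hne
      linear_combination h0 + bin s b * bin m q.1 * bin_mul_choose r q.2 c
    · rintro ⟨a, b⟩ _ _
      linear_combination - bin s b * bin m q.1 * bin_mul_choose r q.2 a
  · rw [mul_zero]
    refine Finset.sum_eq_zero ?_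
    rintro ⟨a, b⟩ hp
    simp only [Finset.HasAntidiagonal.mem_antidiagonal] at hp
    rw [bin_natCast a, Nat.choose_eq_zero_of_lt (by omega)]
    simp

/-- Both sides of the deformed Jacobi identity are the same combination of the `c i j`. -/
theorem deformed_jacobi_core (N : ℕ) (a b c : ℕ → ℕ → V) (κ : ℕ → ℂ) (ε : ℂ) (l m r s : ℚ)
    (hc : ∀ i j, N ≤ i ∨ N ≤ j → c i j = 0)
    (jac : ∀ α β, ∑ i ∈ Finset.range N, κ i • (a (i + β) (α + β) - ε • b (i + α) (α + β))
      = ∑ i ∈ Finset.range N, bin (m + α) i • c i (α + β)) :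
    ∑ i ∈ Finset.range N, κ i •
        ((∑ α ∈ Finset.range N, ∑ β ∈ Finset.range N, (bin r α * bin s β) • a (i + β) (α + β))
        - ε • ∑ α ∈ Finset.range N, ∑ β ∈ Finset.range N,
            (bin r α * bin s β) • b (i + α) (α + β))
      = ∑ t ∈ Finset.range N, ∑ k ∈ Finset.range N, (bin m t * bin (l + t + 1) k) •
          ∑ g ∈ Finset.range N, ∑ δ ∈ Finset.range N,
            (bin r g * bin (r + s - l - t - g - 1) δ) • c (t + g) (g + k + δ) := by
  -- The left side is a weighted sum of ordinary Jacobi identities, one for each shift (α, β) of the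
  -- exponents (m, n). Replacing each by its right side leaves a combination of the `c i j`.
  have hL : ∑ i ∈ Finset.range N, κ i •
        ((∑ α ∈ Finset.range N, ∑ β ∈ Finset.range N, (bin r α * bin s β) • a (i + β) (α + β))
        - ε • ∑ α ∈ Finset.range N, ∑ β ∈ Finset.range N,
            (bin r α * bin s β) • b (i + α) (α + β))
      = ∑ i ∈ Finset.range N, ∑ j ∈ Finset.range N,
          (∑ p ∈ Finset.HasAntidiagonal.antidiagonal j, bin r p.1 * bin s p.2 * bin (m + p.1) i) • c i j := by
    calc _ = ∑ α ∈ Finset.range N, ∑ β ∈ Finset.range N, (bin r α * bin s β) •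
          ∑ i ∈ Finset.range N, κ i • (a (i + β) (α + β) - ε • b (i + α) (α + β)) := by
          simp only [Finset.smul_sum, ← Finset.sum_sub_distrib]
          rw [Finset.sum_comm]
          refine Finset.sum_congr rfl fun α _ => ?_
          rw [Finset.sum_comm]
          refine Finset.sum_congr rfl fun β _ => Finset.sum_congr rfl fun i _ => ?_
          module
      _ = ∑ i ∈ Finset.range N, ∑ α ∈ Finset.range N, ∑ β ∈ Finset.range N,
            (bin r α * bin s β * bin (m + α) i) • c i (α + β) := by
          simp only [jac, Finset.smul_sum, smul_smul]
          symm
          rw [Finset.sum_comm]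
          exact Finset.sum_congr rfl fun α _ => Finset.sum_comm
      _ = _ := by
          refine Finset.sum_congr rfl fun i _ => ?_
          rw [sum_range_eq_sum_antidiagonal N
            (fun α β => (bin r α * bin s β * bin (m + α) i) • c i (α + β))
            (fun α β h => by rw [hc _ _ (Or.inr h), smul_zero])]
          refine Finset.sum_congr rfl fun j _ => ?_
          rw [Finset.sum_smul]
          refine Finset.sum_congr rfl fun p hp => ?_
          rw [Finset.HasAntidiagonal.mem_antidiagonal.mp hp]
  -- The exponents l + t + 1 and r + s - l - t - g - 1 add up to r + s - g, so Vandermonde's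
  -- identity merges the sums over k and δ. This is where the correction factor with exponent l + t
  -- + 1 is forced.
  have hR : ∀ t g : ℕ, ∑ k ∈ Finset.range N, ∑ δ ∈ Finset.range N,
        (bin (l + t + 1) k * bin (r + s - l - t - g - 1) δ) • c (t + g) (g + k + δ)
      = ∑ j ∈ Finset.range N,
          (if g ≤ j then bin (r + s - g) (j - g) else 0) • c (t + g) j := by
    intro t g
    rw [← sum_range_shift N g (bin (r + s - g)) (c (t + g)) (fun j hj => hc _ _ (Or.inr hj)),
      sum_range_eq_sum_antidiagonal N
        (fun k δ => (bin (l + t + 1) k * bin (r + s - l - t - g - 1) δ) • c (t + g) (g + k + δ))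
        (fun k δ h => by rw [hc _ _ (Or.inr (by omega)), smul_zero])]
    refine Finset.sum_congr rfl fun j _ => ?_
    rw [show r + s - (g : ℚ) = (l + t + 1) + (r + s - l - t - g - 1) by ring, bin_add,
      Finset.sum_smul]
    refine Finset.sum_congr rfl fun p hp => ?_
    rw [← Finset.HasAntidiagonal.mem_antidiagonal.mp hp, ← add_assoc g]
  rw [hL]
  symm
  calc _ = ∑ t ∈ Finset.range N, ∑ g ∈ Finset.range N, (bin m t * bin r g) •
          ∑ k ∈ Finset.range N, ∑ δ ∈ Finset.range N,
            (bin (l + t + 1) k * bin (r + s - l - t - g - 1) δ) • c (t + g) (g + k + δ) := by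
        refine Finset.sum_congr rfl fun t _ => ?_
        simp only [Finset.smul_sum]
        rw [Finset.sum_comm]
        refine Finset.sum_congr rfl fun g _ => Finset.sum_congr rfl fun k _ =>
          Finset.sum_congr rfl fun δ _ => ?_
        module
    _ = ∑ i ∈ Finset.range N, ∑ p ∈ Finset.HasAntidiagonal.antidiagonal i, (bin m p.1 * bin r p.2) •
          ∑ j ∈ Finset.range N,
            (if p.2 ≤ j then bin (r + s - p.2) (j - p.2) else 0) • c (p.1 + p.2) j := by
        simp only [hR]
        refine sum_range_eq_sum_antidiagonal N (fun t g => (bin m t * bin r g) •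
          ∑ j ∈ Finset.range N, (if g ≤ j then bin (r + s - g) (j - g) else 0) • c (t + g) j) ?_
        intro t g h
        simp [hc _ _ (Or.inl h)]
    _ = _ := by
        refine Finset.sum_congr rfl fun i _ => ?_
        simp only [sum_bin_mul_bin, Finset.smul_sum, Finset.sum_smul]
        rw [Finset.sum_comm]
        refine Finset.sum_congr rfl fun j _ => Finset.sum_congr rfl fun p hp => ?_
        rw [Finset.HasAntidiagonal.mem_antidiagonal.mp hp, smul_smul]

end Sums

/-! ### Signs. -/

theorem sgn_add (p q : ℤ) : sgn (p + q) = sgn p * sgn q :=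
  zpow_add₀ (by norm_num) p q

theorem sgn_of_even {p : ℤ} (h : Even p) : sgn p = 1 := h.neg_one_zpow

theorem sgn_of_odd {p : ℤ} (h : Odd p) : sgn p = -1 := h.neg_one_zpow

theorem sgn_zero : sgn 0 = 1 := zpow_zero _

theorem sgn_mul_self (p : ℤ) : sgn p * sgn p = 1 := by
  rcases Int.even_or_odd p with h | h
  · simp [sgn_of_even h]
  · simp [sgn_of_odd h]

/-! ### Decompositions into homogeneous components -/

section Decomposition

variable {V : Type u} [AddCommGroup V] [Module ℂ V] {N : Type u} [AddCommGroup N] [Module ℂ N]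

/-- Used to extend to all of V the deformed modes, which are given by a formula on each weight
space, and the parity, which is given on each degree. -/
theorem exists_linearMap_of_isInternal {p : ℤ → Submodule ℂ V} (h : DirectSum.IsInternal p)
    (f : ℤ → V →ₗ[ℂ] N) : ∃ g : V →ₗ[ℂ] N, ∀ i, ∀ x ∈ p i, g x = f i x := by
  let e := LinearEquiv.ofBijective (DirectSum.coeLinearMap p) h
  refine ⟨(DirectSum.toModule ℂ ℤ N fun i => (f i).comp (p i).subtype).comp e.symm.toLinearMap,
    fun i x hx => ?_⟩
  have he : e.symm x = DirectSum.lof ℂ ℤ (fun i => p i) i ⟨x, hx⟩ := by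
    rw [LinearEquiv.symm_apply_eq]
    exact (DirectSum.coeLinearMap_lof p i ⟨x, hx⟩).symm
  simp [he]

theorem exists_projections {p : ℤ → Submodule ℂ V} (h : DirectSum.IsInternal p) :
    ∃ e : ℤ → V →ₗ[ℂ] V, (∀ i v, e i v ∈ p i) ∧ (∀ i, ∀ v ∈ p i, e i v = v) ∧
      (∀ i j, i ≠ j → ∀ v ∈ p j, e i v = 0) ∧ ∀ v, v ∈ Submodule.span ℂ {w | ∃ i, w = e i v} := by
  let := h.chooseDecomposition
  refine ⟨fun i => ((p i).subtype.comp (DirectSum.component ℂ ℤ (fun i => p i) i)).comp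
    (DirectSum.decomposeLinearEquiv p).toLinearMap, fun i v => ?_, fun i v hv => ?_,
    fun i j hij v hv => ?_, fun v => ?_⟩
  · simp
  · simpa using! DirectSum.decompose_of_mem_same p hv
  · simpa using! DirectSum.decompose_of_mem_ne p hv hij.symm
  · classical
    have hv : ∑ i ∈ (DirectSum.decompose p v).support, (DirectSum.decompose p v i : V)
        ∈ Submodule.span ℂ {w | ∃ i, w = (DirectSum.decompose p v i : V)} :=
      Submodule.sum_mem _ fun i _ => Submodule.subset_span ⟨i, rfl⟩
    rwa [DirectSum.sum_support_decompose] at hv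

theorem isInternal_induction {p : ℤ → Submodule ℂ V} (h : DirectSum.IsInternal p)
    {P : V → Prop} (hp : ∀ i, ∀ v ∈ p i, P v) (hadd : ∀ x y, P x → P y → P (x + y)) (v : V) :
    P v := by
  have hv : v ∈ ⨆ i, p i := by
    rw [h.submodule_iSup_eq_top]
    exact Submodule.mem_top
  exact Submodule.iSup_induction p (motive := P) hv hp (hp 0 0 (zero_mem _)) hadd

/-- An operator that preserves the components of a grading commutes with the projections. -/
theorem projection_comm {p : ℤ → Submodule ℂ V} (h : DirectSum.IsInternal p) {T : V →ₗ[ℂ] V}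
    (hT : ∀ i, ∀ v ∈ p i, T v ∈ p i) {e : ℤ → V →ₗ[ℂ] V}
    (h1 : ∀ i, ∀ v ∈ p i, e i v = v) (h0 : ∀ i j, i ≠ j → ∀ v ∈ p j, e i v = 0) (i : ℤ) (v : V) :
    e i (T v) = T (e i v) := by
  induction v using isInternal_induction h with
  | hp j v hv =>
    by_cases hij : i = j
    · subst hij
      rw [h1 i v hv, h1 i _ (hT i v hv)]
    · rw [h0 i j hij v hv, h0 i j hij _ (hT j v hv), map_zero]
  | hadd x y hx hy => simp only [map_add, hx, hy]

theorem eigenspace_le_iSup_inf {p : ℤ → Submodule ℂ V}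
    (h : DirectSum.IsInternal p) {T : V →ₗ[ℂ] V} (hT : ∀ i, ∀ v ∈ p i, T v ∈ p i) (c : ℂ) :
    Module.End.eigenspace T c ≤ ⨆ i, p i ⊓ Module.End.eigenspace T c := by
  obtain ⟨e, hm, h1, h0, hs⟩ := exists_projections h
  intro v hv
  refine Submodule.span_le.mpr ?_ (hs v)
  rintro _ ⟨i, rfl⟩
  refine Submodule.mem_iSup_of_mem i ⟨hm i v, Module.End.mem_eigenspace_iff.mpr ?_⟩
  rw [Module.End.mem_eigenspace_iff] at hv
  rw [← projection_comm h hT h1 h0, hv, map_smul]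

theorem le_iSup_inf_eigenspace {p : ℤ → Submodule ℂ V}
    (h : DirectSum.IsInternal p) {T : V →ₗ[ℂ] V} (hT : ∀ i, ∀ v ∈ p i, T v ∈ p i)
    {c : ℤ → ℂ}
    (hc : DirectSum.IsInternal fun k => Module.End.eigenspace T (c k)) (i : ℤ) :
    p i ≤ ⨆ k, p i ⊓ Module.End.eigenspace T (c k) := by
  obtain ⟨e, hm, h1, h0, -⟩ := exists_projections h
  intro v hv
  rw [← h1 i v hv]
  clear hv
  induction v using isInternal_induction hc with
  | hp k v hv =>
    refine Submodule.mem_iSup_of_mem k ⟨hm i v, Module.End.mem_eigenspace_iff.mpr ?_⟩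
    rw [Module.End.mem_eigenspace_iff] at hv
    rw [← projection_comm h hT h1 h0, hv, map_smul]
  | hadd x y hx hy => rw [map_add]; exact add_mem hx hy

end Decomposition

/-! ### Finite sums -/

section Sums

variable {V : Type u} [AddCommGroup V]

theorem finsum_eq_sum_range {f : ℕ → V} {N : ℕ} (h : ∀ i, N ≤ i → f i = 0) :
    ∑ᶠ i, f i = ∑ i ∈ Finset.range N, f i := by
  apply finsum_eq_finsetSum_of_support_subset
  intro i hi
  rw [Finset.coe_range, Set.mem_Iio]
  by_contra hc
  exact hi (h i (not_lt.mp hc))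

/-- Truncation bounds the outer mode only after the inner one is fixed. As only finitely many inner
modes are nonzero, the bounds can be made uniform. -/
theorem exists_bound {f : ℕ → ℕ → V} (h₁ : ∃ K, ∀ x y, K ≤ x → f x y = 0)
    (h₂ : ∀ x, ∃ K, ∀ y, K ≤ y → f x y = 0) :
    ∃ N, ∀ x y, N ≤ x ∨ N ≤ y → f x y = 0 := by
  obtain ⟨K, hK⟩ := h₁
  choose g hg using h₂
  refine ⟨K + ∑ x ∈ Finset.range K, g x, fun x y h => ?_⟩
  by_cases hx : K ≤ x
  · exact hK x y hx
  · refine hg x y ?_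
    have := Finset.single_le_sum (f := g) (fun _ _ => Nat.zero_le _)
      (Finset.mem_range.mpr (not_le.mp hx))
    omega

variable [Module ℂ V]

/-- The terms that survive when the second vector in the Jacobi identity is the vacuum. -/
theorem sum_vacuum (f : ℤ → V) (n : ℤ) (N : ℕ) (hN : n.natAbs + 1 ≤ N) :
    ∑ i ∈ Finset.range N, ((-1 : ℂ) ^ i * bin (-2) i) •
        ((if n + i = -1 then f (-2 - i) else 0) - (if n - 2 - i = -1 then f i else 0))
      = (-(n : ℂ)) • f (n - 1) := by
  have hb : ∀ i : ℕ, (-1 : ℂ) ^ i * bin (-2) i = i + 1 := by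
    intro i
    rw [bin_neg_two, ← mul_assoc, ← mul_pow]
    simp
  simp only [hb]
  rcases lt_trichotomy n 0 with hn | rfl | hn
  · obtain ⟨k, rfl⟩ : ∃ k : ℕ, n = -1 - k := ⟨(-1 - n).toNat, by omega⟩
    rw [Finset.sum_eq_single k]
    · rw [if_pos (by ring), if_neg (by omega), sub_zero, show (-2 - k : ℤ) = -1 - k - 1 by ring]
      congr 1
      push_cast
      ring
    · intro i _ hi
      rw [if_neg (by omega), if_neg (by omega), sub_zero, smul_zero]
    · intro hk
      rw [Finset.mem_range] at hk
      omega
  · rw [Finset.sum_eq_zero]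
    · simp
    · intro i _
      rw [if_neg (by omega), if_neg (by omega), sub_zero, smul_zero]
  · obtain ⟨k, rfl⟩ : ∃ k : ℕ, n = k + 1 := ⟨(n - 1).toNat, by omega⟩
    rw [Finset.sum_eq_single k]
    · rw [if_neg (by omega), if_pos (by ring), zero_sub, smul_neg, ← neg_smul,
        add_sub_cancel_right]
      congr 1
      push_cast
      ring
    · intro i _ hi
      rw [if_neg (by omega), if_neg (by omega), sub_zero, smul_zero]
    · intro hk
      rw [Finset.mem_range] at hk
      omega

end Sums

section

variable {V : Type u} [AddCommGroup V] [Module ℂ V] (X : DGVertexOperatorAlgebra V)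

/-! ### Weights -/

theorem mem_wtSpace {k : ℤ} {v : V} :
    v ∈ wtSpace X k ↔ X.mode 1 X.conf v = ((k : ℂ) / 2) • v :=
  Module.End.mem_eigenspace_iff

/-- The translation formula (L(-1)u)_n = -n u_(n-1): the Jacobi identity with second vector the
vacuum, l = -2 and m = 0. -/
theorem mode_mode_vac (n p : ℤ) {u : V} (hu : u ∈ X.deg p) (w : V) :
    X.mode n (X.mode (-2) u X.vac) w = (-(n : ℂ)) • X.mode (n - 1) u w := by
  have J := X.jacobi (-2) 0 n p 0 u hu X.vac X.vac_deg w
  obtain ⟨N, hN⟩ := X.truncation u w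
  rw [finsum_eq_sum_range (N := N.natAbs + n.natAbs + 1) (fun i hi => by
      rw [X.vacuum, X.vacuum, if_neg (by omega), map_zero, hN _ (by omega), ite_self, smul_zero,
        sub_zero, smul_zero]),
    finsum_eq_single _ 0 (fun i hi => by
      rw [bin_intCast, Int.cast_zero, bin_zero_left, if_neg hi, zero_smul])] at J
  rw [← sum_vacuum (fun j => X.mode j u w) n (N.natAbs + n.natAbs + 1) (by omega)]
  simp only [bin_intCast, Int.cast_zero, bin_zero_right, one_smul, Nat.cast_zero, sub_zero,
    zero_add, add_zero] at J
  rw [← J]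
  refine Finset.sum_congr rfl fun i _ => ?_
  rw [X.vacuum, X.vacuum, mul_zero, sgn_zero, mul_one, sgn_of_even (by decide), one_smul,
    apply_ite (X.mode _ u), map_zero]
  simp [sub_eq_add_neg]

/-- The Jacobi identity for ω and u with l = 0 and m = 1 expresses [ω_1, u_n] through (ω_0 u)_(n+1)
and (ω_1 u)_n. The first is a translate, evaluated by `mode_mode_vac`. -/
theorem weight_mode (n p : ℤ) {u : V} (hu : u ∈ X.deg p) (w : V) :
    X.mode 1 X.conf (X.mode n u w) = X.mode n (X.mode 1 X.conf u) w
      + X.mode n u (X.mode 1 X.conf w) - ((n : ℂ) + 1) • X.mode n u w := by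
  have J := X.jacobi 0 1 n 4 p X.conf X.conf_deg u hu w
  rw [finsum_eq_single _ 0 (fun i hi => by
      rw [bin_intCast, Int.cast_zero, bin_zero_left, if_neg hi, mul_zero, zero_smul]),
    finsum_eq_sum_range (N := 2) (fun i hi => by
      rw [bin_intCast, ← Nat.cast_one, Int.cast_natCast, bin_natCast,
        Nat.choose_eq_zero_of_lt (by omega)]
      simp), Finset.sum_range_succ, Finset.sum_range_one] at J
  have h1 : bin 1 1 = 1 := by rw [← Nat.cast_one, bin_natCast]; simp
  simp only [bin_intCast, Int.cast_zero, Int.cast_one, bin_zero_right, h1, one_smul, Nat.cast_zero,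
    Nat.cast_one, sub_zero, zero_add, add_zero, pow_zero, mul_one, sgn_zero, X.translation,
    sgn_of_even (show Even (4 * p) from ⟨2 * p, by ring⟩), mode_mode_vac X _ p hu] at J
  rw [add_sub_cancel_left, sub_eq_iff_eq_add] at J
  rw [J]
  push_cast
  module

/-- Since ω has degree 4, L(0) preserves the degree. Degree and weight can therefore be diagonalised
together. -/
theorem weight_deg (p : ℤ) : ∀ v ∈ X.deg p, X.mode 1 X.conf v ∈ X.deg p := by
  intro v hv
  have h := X.mode_deg 1 4 p X.conf X.conf_deg v hv
  rwa [show (4 : ℤ) + p - 2 * 1 - 2 = p by ring] at h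

theorem wtSpace_le (k : ℤ) : wtSpace X k ≤ ⨆ p, X.deg p ⊓ wtSpace X k :=
  eigenspace_le_iSup_inf X.deg_internal (weight_deg X) _

theorem deg_le (p : ℤ) : X.deg p ≤ ⨆ k, X.deg p ⊓ wtSpace X k :=
  le_iSup_inf_eigenspace X.deg_internal (weight_deg X) X.wt_internal p

/-- The vectors that are homogeneous for degree and weight span `V`. -/
theorem homogeneous_induction {P : V → Prop}
    (h : ∀ p k, ∀ v ∈ X.deg p, v ∈ wtSpace X k → P v)
    (hadd : ∀ x y, P x → P y → P (x + y)) (v : V) : P v := by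
  induction v using isInternal_induction X.deg_internal with
  | hp p v hv =>
    exact Submodule.iSup_induction _ (motive := P) (deg_le X p hv) (fun k v hv => h p k v hv.1 hv.2)
      (h 0 0 0 (zero_mem _) (zero_mem _)) hadd
  | hadd x y hx hy => exact hadd x y hx hy

theorem wt_homogeneous_induction {k : ℤ} {P : V → Prop}
    (h : ∀ p, ∀ v ∈ X.deg p, v ∈ wtSpace X k → P v)
    (hadd : ∀ x y, P x → P y → P (x + y)) (v : V) (hv : v ∈ wtSpace X k) : P v :=
  Submodule.iSup_induction _ (motive := P) (wtSpace_le X k hv) (fun p v hv => h p v hv.1 hv.2)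
      (h 0 0 (zero_mem _) (zero_mem _)) hadd

theorem deg_homogeneous_induction {p : ℤ} {P : V → Prop}
    (h : ∀ k, ∀ v ∈ X.deg p, v ∈ wtSpace X k → P v)
    (hadd : ∀ x y, P x → P y → P (x + y)) (v : V) (hv : v ∈ X.deg p) : P v :=
  Submodule.iSup_induction _ (motive := P) (deg_le X p hv) (fun k v hv => h k v hv.1 hv.2)
      (h 0 0 (zero_mem _) (zero_mem _)) hadd

theorem mode_wt (n k l : ℤ) (u : V) (hu : u ∈ wtSpace X k) (v : V) (hv : v ∈ wtSpace X l) :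
    X.mode n u v ∈ wtSpace X (k + l - 2 * n - 2) := by
  refine wt_homogeneous_induction X (P := fun u => X.mode n u v ∈ wtSpace X (k + l - 2 * n - 2))
    (fun p u hp hu => ?_) (fun x y hx hy => ?_) u hu
  · rw [mem_wtSpace] at *
    rw [weight_mode X n p hp, hu, hv, map_smul, map_smul, LinearMap.smul_apply]
    push_cast
    module
  · rw [map_add, LinearMap.add_apply]; exact add_mem hx hy

theorem d_wt (k : ℤ) (v : V) (hv : v ∈ wtSpace X k) : X.d v ∈ wtSpace X k := by
  rw [mem_wtSpace] at *
  have h := X.d_mode 1 4 X.conf X.conf_deg v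
  rw [X.d_conf, map_zero, LinearMap.zero_apply, zero_add, sgn_of_even (by decide), one_smul, hv,
    map_smul] at h
  exact h.symm

theorem vac_wt : X.vac ∈ wtSpace X 0 := by
  rw [mem_wtSpace, X.creation 1 _ (by decide)]
  simp

/-! ### The modes of the Zhu algebra -/

theorem mode_support_finite (f : ℕ → ℂ) (n : ℤ) (u v : V) :
    (Function.support fun i : ℕ => f i • X.mode (i + n) u v).Finite := by
  obtain ⟨N, hN⟩ := X.truncation u v
  refine (Finset.range (N - n).toNat).finite_toSet.subset fun i hi => ?_
  rw [Finset.coe_range, Set.mem_Iio]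
  by_contra hc
  exact hi (by simp only [hN (i + n) (by omega), smul_zero])

/-- `∑ binom(r, i) u_(n+i) v`. -/
noncomputable def zmodeAux (r : ℚ) (n : ℤ) : V →ₗ[ℂ] V →ₗ[ℂ] V :=
  LinearMap.mk₂ ℂ (fun u v => ∑ᶠ i : ℕ, bin r i • X.mode (i + n) u v)
    (fun u u' v => by
      rw [← finsum_add_distrib (mode_support_finite X _ n u v) (mode_support_finite X _ n u' v)]
      exact finsum_congr fun i => by simp)
    (fun c u v => by
      rw [smul_finsum' _ (mode_support_finite X _ n u v)]
      exact finsum_congr fun i => by rw [map_smul, LinearMap.smul_apply, smul_comm])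
    (fun u v v' => by
      rw [← finsum_add_distrib (mode_support_finite X _ n u v) (mode_support_finite X _ n u v')]
      exact finsum_congr fun i => by simp)
    (fun c u v => by
      rw [smul_finsum' _ (mode_support_finite X _ n u v)]
      exact finsum_congr fun i => by rw [map_smul, smul_comm])

/-- The coefficient of `x^(-n-1)` in `(1 + x)^(wt u) Y(u, x) v`, linear in `u`. -/
noncomputable def zmode (n : ℤ) : V →ₗ[ℂ] V →ₗ[ℂ] V :=
  (exists_linearMap_of_isInternal X.wt_internal fun k => zmodeAux X (k / 2) n).choose

theorem zmode_apply (n k : ℤ) {u : V} (hu : u ∈ wtSpace X k) (v : V) :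
    zmode X n u v = ∑ᶠ i : ℕ, bin (k / 2) i • X.mode (i + n) u v := by
  unfold zmode
  rw [(exists_linearMap_of_isInternal X.wt_internal fun k =>
    zmodeAux X (k / 2) n).choose_spec k u hu]
  rfl

theorem star_eq (k : ℤ) {u : V} (hu : u ∈ wtSpace X k) (v : V) :
    star X k u v = zmode X (-1) u v :=
  by
  rw [zmode_apply X (-1) k hu v]
  rfl

theorem circ_eq (k : ℤ) {u : V} (hu : u ∈ wtSpace X k) (v : V) :
    circ X k u v = zmode X (-2) u v :=
  by
  rw [zmode_apply X (-2) k hu v]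
  rfl

theorem zmode_eq_sum (n k : ℤ) {u : V} (hu : u ∈ wtSpace X k) (v : V) (N : ℕ)
    (hN : ∀ i : ℕ, N ≤ i → X.mode (n + i) u v = 0) :
    zmode X n u v = ∑ i ∈ Finset.range N, bin (k / 2) i • X.mode (n + i) u v := by
  rw [zmode_apply X n k hu, finsum_eq_sum_range (N := N)]
  · simp only [add_comm]
  · intro i hi
    rw [add_comm, hN i hi, smul_zero]

/-- The lower index grows with n and binomial coefficients never reach back, so the truncation of
the ordinary modes is inherited. -/
theorem zmode_truncation (u v : V) : ∃ N : ℤ, ∀ n, N ≤ n → zmode X n u v = 0 := by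
  induction u using isInternal_induction X.wt_internal with
  | hp k u hu =>
    obtain ⟨N, hN⟩ := X.truncation u v
    refine ⟨N, fun n hn => ?_⟩
    rw [zmode_eq_sum X n k hu v 0 fun i _ => hN _ (by omega), Finset.sum_range_zero]
  | hadd x y hx hy =>
    obtain ⟨N, hN⟩ := hx
    obtain ⟨N', hN'⟩ := hy
    refine ⟨max N N', fun n hn => ?_⟩
    rw [map_add, LinearMap.add_apply, hN n (le_of_max_le_left hn), hN' n (le_of_max_le_right hn),
      add_zero]

theorem zmode_vac (n : ℤ) (v : V) : zmode X n X.vac v = if n = -1 then v else 0 := by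
  rw [zmode_apply X n 0 (vac_wt X), finsum_eq_single _ 0, X.vacuum]
  · simp [bin_zero_right]
  · intro i hi
    simp [bin_zero_left, hi]

theorem zmode_neg_one_vac (v : V) : zmode X (-1) v X.vac = v := by
  induction v using isInternal_induction X.wt_internal with
  | hp k v hv =>
    rw [zmode_eq_sum X (-1) k hv _ 1 fun i _ => X.creation _ _ (by omega), Finset.sum_range_one,
      bin_zero_right, one_smul, Nat.cast_zero, add_zero, X.creation_neg_one]
  | hadd x y hx hy => rw [map_add, LinearMap.add_apply, hx, hy]

/-- The differential preserves weights, so u and du are deformed by the same binomial coefficients.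
-/
theorem d_zmode (n p : ℤ) (u : V) (hu : u ∈ X.deg p) (v : V) :
    X.d (zmode X n u v) = zmode X n (X.d u) v + sgn p • zmode X n u (X.d v) := by
  refine deg_homogeneous_induction X (P := fun u => X.d (zmode X n u v)
    = zmode X n (X.d u) v + sgn p • zmode X n u (X.d v)) (fun k u hp hk => ?_)
    (fun x y hx hy => ?_) u hu
  · rw [zmode_apply X n k hk, zmode_apply X n k hk, zmode_apply X n k (d_wt X k u hk),
      smul_finsum' _ (mode_support_finite X _ n u (X.d v)), ← finsum_add_distrib
      (mode_support_finite X _ n (X.d u) v) (by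
        simp only [smul_comm (sgn p), ← map_smul _ (sgn p)]
        exact mode_support_finite X _ n u _)]
    have h := X.d.toAddMonoidHom.map_finsum (mode_support_finite X (bin (k / 2)) n u v)
    refine h.trans (finsum_congr fun i => ?_)
    simp only [LinearMap.toAddMonoidHom_coe]
    rw [map_smul, X.d_mode _ p u hp, smul_add, smul_comm]
  · simp only [map_add, LinearMap.add_apply, hx, hy, smul_add]
    abel

/-- Degree and doubled weight are shifted by the same amount. -/
theorem zmode_mem {M : ℤ → Submodule ℂ V} {p q : ℤ} {u v : V}
    (hM : ∀ n, X.mode n u v ∈ M (p + q - 2 * n - 2)) (n k : ℤ) (hk : u ∈ wtSpace X k) :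
    zmode X n u v ∈ ⨆ r : ℤ, ⨆ _ : Even (p + q - r) ∧ r ≤ p + q - 2 * n - 2, M r := by
  obtain ⟨N, hN⟩ := X.truncation u v
  rw [zmode_eq_sum X n k hk v (N - n).toNat fun i _ => hN _ (by omega)]
  refine Submodule.sum_mem _ fun i _ => Submodule.smul_mem _ _ ?_
  exact Submodule.mem_iSup_of_mem _ (Submodule.mem_iSup_of_mem
    ⟨⟨n + i + 1, by ring⟩, by omega⟩ (hM (n + i)))

end

section

variable {V : Type u} [AddCommGroup V] [Module ℂ V] (X : DGVertexOperatorAlgebra V)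

/-! ### The Jacobi identity for the modes of the Zhu algebra -/

theorem zmode_zmode_right (a b k l : ℤ) {u v : V} (hu : u ∈ wtSpace X k) (hv : v ∈ wtSpace X l)
    (w : V) (N : ℕ) (h₁ : ∀ j : ℕ, N ≤ j → X.mode (b + j) v w = 0)
    (h₂ : ∀ i j : ℕ, N ≤ i → X.mode (a + i) u (X.mode (b + j) v w) = 0) :
    zmode X a u (zmode X b v w) = ∑ i ∈ Finset.range N, ∑ j ∈ Finset.range N,
      (bin (k / 2) i * bin (l / 2) j) • X.mode (a + i) u (X.mode (b + j) v w) := by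
  rw [zmode_eq_sum X b l hv w N h₁, map_sum, Finset.sum_comm]
  refine Finset.sum_congr rfl fun j _ => ?_
  rw [map_smul, zmode_eq_sum X a k hu _ N fun i hi => h₂ i j hi, Finset.smul_sum]
  exact Finset.sum_congr rfl fun i _ => by rw [smul_smul, mul_comm]

/-- The weight of u_(a+i) v drops as i grows, so the exponent of the outer deformation depends on i.
-/
theorem zmode_zmode_left (a b k l : ℤ) {u v : V} (hu : u ∈ wtSpace X k) (hv : v ∈ wtSpace X l)
    (w : V) (N : ℕ) (h₁ : ∀ i : ℕ, N ≤ i → X.mode (a + i) u v = 0)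
    (h₂ : ∀ i j : ℕ, N ≤ j → X.mode (b + j) (X.mode (a + i) u v) w = 0) :
    zmode X b (zmode X a u v) w = ∑ i ∈ Finset.range N, ∑ j ∈ Finset.range N,
      (bin (k / 2) i * bin (k / 2 + l / 2 - a - i - 1) j) •
        X.mode (b + j) (X.mode (a + i) u v) w := by
  rw [zmode_eq_sum X a k hu v N h₁, map_sum, LinearMap.sum_apply]
  refine Finset.sum_congr rfl fun i _ => ?_
  rw [map_smul, LinearMap.smul_apply, zmode_eq_sum X b _ (mode_wt X (a + i) k l u hu v hv) w N
    fun j hj => h₂ i j hj, Finset.smul_sum]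
  refine Finset.sum_congr rfl fun j _ => ?_
  rw [smul_smul]
  congr 3
  push_cast
  ring

/-- The sums are cut at an arbitrary large N, not written as `finsum`: identities for different
vectors can then be added at a common N. -/
theorem zmode_jacobi_homogeneous (l m n p q k k' : ℤ) {u v : V} (hp : u ∈ X.deg p)
    (hu : u ∈ wtSpace X k) (hq : v ∈ X.deg q) (hv : v ∈ wtSpace X k') (w : V) :
    ∃ N₀ : ℕ, ∀ N, N₀ ≤ N →
      ∑ i ∈ Finset.range N, ((-1 : ℂ) ^ i * bin l i) •
        (zmode X (m + l - i) u (zmode X (n + i) v w)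
          - (sgn l * sgn (p * q)) • zmode X (n + l - i) v (zmode X (m + i) u w))
      = ∑ t ∈ Finset.range N, ∑ j ∈ Finset.range N, (bin m t * bin (l + t + 1) j) •
          zmode X (m + n - t + j) (zmode X (l + t) u v) w := by
  obtain ⟨Nu, hNu⟩ := X.truncation u w
  obtain ⟨Nv, hNv⟩ := X.truncation v w
  obtain ⟨Nuv, hNuv⟩ := X.truncation u v
  obtain ⟨Na, ha⟩ := exists_bound
    (f := fun x y : ℕ => X.mode (m + l - x + y) u (X.mode (n + x) v w))
    ⟨(Nv - n).toNat, fun x y hx => by rw [hNv _ (by omega), map_zero]⟩ fun x => by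
      obtain ⟨K, hK⟩ := X.truncation u (X.mode (n + x) v w)
      exact ⟨(K - m - l + x).toNat, fun y hy => hK _ (by omega)⟩
  obtain ⟨Nb, hb⟩ := exists_bound
    (f := fun x y : ℕ => X.mode (n + l - x + y) v (X.mode (m + x) u w))
    ⟨(Nu - m).toNat, fun x y hx => by rw [hNu _ (by omega), map_zero]⟩ fun x => by
      obtain ⟨K, hK⟩ := X.truncation v (X.mode (m + x) u w)
      exact ⟨(K - n - l + x).toNat, fun y hy => hK _ (by omega)⟩
  obtain ⟨Nc, hc⟩ := exists_bound
    (f := fun x y : ℕ => X.mode (m + n - x + y) (X.mode (l + x) u v) w)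
    ⟨(Nuv - l).toNat, fun x y hx => by
      rw [hNuv _ (by omega), map_zero, LinearMap.zero_apply]⟩ fun x => by
      obtain ⟨K, hK⟩ := X.truncation (X.mode (l + x) u v) w
      exact ⟨(K - m - n + x).toNat, fun y hy => hK _ (by omega)⟩
  refine ⟨Na + Nb + Nc + (Nu - m).toNat + (Nv - n).toNat + (Nuv - l).toNat, fun N hN => ?_⟩
  -- The first index of each family is the number of steps from the inner mode at α = β = i = 0, the
  -- second the total shift α + β. In these coordinates the Jacobi identities for all shifts read
  -- the same three families.
  have core := deformed_jacobi_core N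
    (fun x y : ℕ => X.mode (m + l - x + y) u (X.mode (n + x) v w))
    (fun x y : ℕ => X.mode (n + l - x + y) v (X.mode (m + x) u w))
    (fun x y : ℕ => X.mode (m + n - x + y) (X.mode (l + x) u v) w)
    (fun i => (-1 : ℂ) ^ i * bin l i) (sgn l * sgn (p * q)) l m (k / 2) (k' / 2)
    (fun i j h => hc i j (by omega)) (fun α β => by
      have J := X.jacobi l (m + α) (n + β) p q u hp v hq w
      have e₁ (i : ℕ) : m + l - ((i + β : ℕ) : ℤ) + ((α + β : ℕ) : ℤ) = m + α + l - i := by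
        push_cast; ring
      have e₂ (i : ℕ) : n + ((i + β : ℕ) : ℤ) = n + β + i := by push_cast; ring
      have e₃ (i : ℕ) : n + l - ((i + α : ℕ) : ℤ) + ((α + β : ℕ) : ℤ) = n + β + l - i := by
        push_cast; ring
      have e₄ (i : ℕ) : m + ((i + α : ℕ) : ℤ) = m + α + i := by push_cast; ring
      have e₅ (i : ℕ) : m + n - i + ((α + β : ℕ) : ℤ) = m + α + (n + β) - i := by
        push_cast; ring
      have e₆ : (m : ℚ) + α = ((m + α : ℤ) : ℚ) := by push_cast; ring
      simp only [bin_intCast] at J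
      simp only [e₁, e₂, e₃, e₄, e₅, e₆]
      rwa [finsum_eq_sum_range (N := N) fun i hi => by
          rw [hNv _ (by omega), hNu _ (by omega), map_zero, map_zero, smul_zero, sub_zero,
            smul_zero],
        finsum_eq_sum_range (N := N) fun i hi => by
          rw [hNuv _ (by omega), map_zero, LinearMap.zero_apply, smul_zero]] at J)
  have hA (i : ℕ) : zmode X (m + l - i) u (zmode X (n + i) v w)
      = ∑ α ∈ Finset.range N, ∑ β ∈ Finset.range N, (bin (k / 2) α * bin (k' / 2) β) •
        X.mode (m + l - (i + β : ℕ) + (α + β : ℕ)) u (X.mode (n + (i + β : ℕ)) v w) := by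
    have e₁ (α β : ℕ) : m + l - ((i + β : ℕ) : ℤ) + ((α + β : ℕ) : ℤ) = m + l - i + α := by
      push_cast; ring
    have e₂ (β : ℕ) : n + ((i + β : ℕ) : ℤ) = n + i + β := by push_cast; ring
    simp only [e₁, e₂]
    refine zmode_zmode_right X _ _ k k' hu hv w N (fun j hj => hNv _ (by omega)) fun α β h => ?_
    rw [← e₁ α β, ← e₂]
    exact ha _ _ (by omega)
  have hB (i : ℕ) : zmode X (n + l - i) v (zmode X (m + i) u w)
      = ∑ α ∈ Finset.range N, ∑ β ∈ Finset.range N, (bin (k / 2) α * bin (k' / 2) β) •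
        X.mode (n + l - (i + α : ℕ) + (α + β : ℕ)) v (X.mode (m + (i + α : ℕ)) u w) := by
    have e₁ (α β : ℕ) : n + l - ((i + α : ℕ) : ℤ) + ((α + β : ℕ) : ℤ) = n + l - i + β := by
      push_cast; ring
    have e₂ (α : ℕ) : m + ((i + α : ℕ) : ℤ) = m + i + α := by push_cast; ring
    rw [Finset.sum_comm]
    simp only [e₁, e₂, mul_comm (bin (k / 2) _)]
    refine zmode_zmode_right X _ _ k' k hv hu w N (fun j hj => hNu _ (by omega)) fun β α h => ?_
    rw [← e₁ α β, ← e₂]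
    exact hb _ _ (by omega)
  have hC (t j : ℕ) : zmode X (m + n - t + j) (zmode X (l + t) u v) w
      = ∑ g ∈ Finset.range N, ∑ δ ∈ Finset.range N,
        (bin (k / 2) g * bin (k / 2 + k' / 2 - l - t - g - 1) δ) •
          X.mode (m + n - (t + g : ℕ) + (g + j + δ : ℕ)) (X.mode (l + (t + g : ℕ)) u v) w := by
    have e₁ (g δ : ℕ) : m + n - ((t + g : ℕ) : ℤ) + ((g + j + δ : ℕ) : ℤ) = m + n - t + j + δ := by
      push_cast; ring
    have e₂ (g : ℕ) : l + ((t + g : ℕ) : ℤ) = l + t + g := by push_cast; ring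
    simp only [e₁, e₂]
    have h := zmode_zmode_left X (l + t) (m + n - t + j) k k' hu hv w N
      (fun g hg => hNuv _ (by omega)) fun g δ h => by
        rw [← e₁ g δ, ← e₂]
        exact hc _ _ (by omega)
    rw [h]
    push_cast
    simp only [sub_sub, add_assoc]
  simp only [hA, hB, hC]
  exact core

theorem zmode_jacobi (l m n p q : ℤ) {u v : V} (hp : u ∈ X.deg p) (hq : v ∈ X.deg q) (w : V) :
    ∃ N₀ : ℕ, ∀ N, N₀ ≤ N →
      ∑ i ∈ Finset.range N, ((-1 : ℂ) ^ i * bin l i) •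
        (zmode X (m + l - i) u (zmode X (n + i) v w)
          - (sgn l * sgn (p * q)) • zmode X (n + l - i) v (zmode X (m + i) u w))
      = ∑ t ∈ Finset.range N, ∑ j ∈ Finset.range N, (bin m t * bin (l + t + 1) j) •
          zmode X (m + n - t + j) (zmode X (l + t) u v) w := by
  let P (u v : V) : Prop := ∃ N₀ : ℕ, ∀ N, N₀ ≤ N →
      ∑ i ∈ Finset.range N, ((-1 : ℂ) ^ i * bin l i) •
        (zmode X (m + l - i) u (zmode X (n + i) v w)
          - (sgn l * sgn (p * q)) • zmode X (n + l - i) v (zmode X (m + i) u w))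
      = ∑ t ∈ Finset.range N, ∑ j ∈ Finset.range N, (bin m t * bin (l + t + 1) j) •
          zmode X (m + n - t + j) (zmode X (l + t) u v) w
  refine deg_homogeneous_induction X (P := fun u => P u v) (fun k u hp hu => ?_) ?_ u hp
  · refine deg_homogeneous_induction X (P := fun v => P u v) (fun k' v hq hv => ?_) ?_ v hq
    · exact zmode_jacobi_homogeneous X l m n p q k k' hp hu hq hv w
    · rintro x y ⟨N₁, h₁⟩ ⟨N₂, h₂⟩
      refine ⟨max N₁ N₂, fun N hN => ?_⟩
      have h := congrArg₂ (· + ·) (h₁ N (le_of_max_le_left hN)) (h₂ N (le_of_max_le_right hN))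
      simp only [← Finset.sum_add_distrib] at h
      simp only [map_add, LinearMap.add_apply, smul_add, add_sub_add_comm] at h ⊢
      exact h
  · rintro x y ⟨N₁, h₁⟩ ⟨N₂, h₂⟩
    refine ⟨max N₁ N₂, fun N hN => ?_⟩
    have h := congrArg₂ (· + ·) (h₁ N (le_of_max_le_left hN)) (h₂ N (le_of_max_le_right hN))
    simp only [← Finset.sum_add_distrib] at h
    simp only [map_add, LinearMap.add_apply, smul_add, add_sub_add_comm] at h ⊢
    exact h

end

section

variable {V : Type u} [AddCommGroup V] [Module ℂ V] (X : DGVertexOperatorAlgebra V)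

/-! ### The subspace `O(V)` is an ideal -/

/-- The case m = 0, where only t = 0 survives: the associativity formula for an iterated mode. -/
theorem zmode_assoc (l n p q : ℤ) {u v : V} (hp : u ∈ X.deg p) (hq : v ∈ X.deg q) (w : V) :
    ∃ N₀ : ℕ, ∀ N, N₀ ≤ N →
      ∑ i ∈ Finset.range N, ((-1 : ℂ) ^ i * bin l i) •
        (zmode X (l - i) u (zmode X (n + i) v w)
          - (sgn l * sgn (p * q)) • zmode X (n + l - i) v (zmode X i u w))
      = ∑ j ∈ Finset.range N, bin (l + 1) j • zmode X (n + j) (zmode X l u v) w := by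
  obtain ⟨N₀, h⟩ := zmode_jacobi X l 0 n p q hp hq w
  refine ⟨N₀ + 1, fun N hN => ?_⟩
  have h := h N (by omega)
  rw [Finset.sum_eq_single_of_mem (s := Finset.range N) 0 (Finset.mem_range.mpr (by omega))
    (fun t _ ht => Finset.sum_eq_zero fun j _ => by
      rw [Int.cast_zero, bin_zero_left, if_neg ht, zero_mul, zero_smul])] at h
  simpa [bin_zero_right] using h

/-- The case l = 0: the commutator formula. The exponent t + 1 is now a natural number, so only j ≤
t + 1 contributes and the outer index is bounded above by m + n + 1. -/
theorem zmode_comm (m n p q : ℤ) {u v : V} (hp : u ∈ X.deg p) (hq : v ∈ X.deg q) (w : V) :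
    ∃ N₀ : ℕ, ∀ N, N₀ ≤ N →
      zmode X m u (zmode X n v w) - sgn (p * q) • zmode X n v (zmode X m u w)
      = ∑ t ∈ Finset.range N, ∑ j ∈ Finset.range N, (bin m t * ((t + 1).choose j : ℂ)) •
          zmode X (m + n - t + j) (zmode X t u v) w := by
  obtain ⟨N₀, h⟩ := zmode_jacobi X 0 m n p q hp hq w
  refine ⟨N₀ + 1, fun N hN => ?_⟩
  have h := h N (by omega)
  rw [Finset.sum_eq_single_of_mem (s := Finset.range N) 0 (Finset.mem_range.mpr (by omega))
    (fun t _ ht => by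
      rw [Int.cast_zero, bin_zero_left, if_neg ht, mul_zero, zero_smul])] at h
  have e (t j : ℕ) : bin ((0 : ℤ) + (t : ℚ) + 1) j = ((t + 1).choose j : ℂ) := by
    rw [← bin_natCast]
    congr 1
    push_cast
    ring
  simp only [e] at h
  simpa [bin_zero_right, sgn_zero] using h

theorem sum_alternating_add_shift (f : ℤ → V) (n : ℤ) (N : ℕ) :
    ∑ j ∈ Finset.range N, bin (-1) j • f (n + j)
      + ∑ j ∈ Finset.range N, bin (-1) j • f (n + 1 + j) = f n - (-1 : ℂ) ^ N • f (n + N) := by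
  induction N with
  | zero => simp
  | succ N ih =>
    rw [Finset.sum_range_succ, Finset.sum_range_succ, add_add_add_comm, ih, bin_neg_one, pow_succ]
    push_cast
    rw [show n + 1 + (N : ℤ) = n + (N + 1) by ring]
    module

/-- For l = -2 the right side of `zmode_assoc` carries the factor (1 + x)^(-1). Adding the
identities for n and n + 1 multiplies by 1 + x, and the alternating sums telescope to a single term.
-/
theorem zmode_zmode_neg_two (n p q : ℤ) {u v : V} (hp : u ∈ X.deg p) (hq : v ∈ X.deg q) (w : V) :
    ∃ N₀ : ℕ, ∀ N, N₀ ≤ N →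
      zmode X n (zmode X (-2) u v) w =
      (∑ i ∈ Finset.range N, ((-1 : ℂ) ^ i * bin (-2) i) •
        (zmode X (-2 - i) u (zmode X (n + i) v w)
          - sgn (p * q) • zmode X (n - 2 - i) v (zmode X i u w))) +
      ∑ i ∈ Finset.range N, ((-1 : ℂ) ^ i * bin (-2) i) •
        (zmode X (-2 - i) u (zmode X (n + 1 + i) v w)
          - sgn (p * q) • zmode X (n + 1 - 2 - i) v (zmode X i u w)) := by
  obtain ⟨N₁, h₁⟩ := zmode_assoc X (-2) n p q hp hq w
  obtain ⟨N₂, h₂⟩ := zmode_assoc X (-2) (n + 1) p q hp hq w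
  obtain ⟨K, hK⟩ := zmode_truncation X (zmode X (-2) u v) w
  refine ⟨N₁ + N₂ + (K - n).toNat, fun N hN => ?_⟩
  have h := congrArg₂ (· + ·) (h₁ N (by omega)) (h₂ N (by omega))
  have e : ((-2 : ℤ) : ℚ) + 1 = -1 := by norm_num
  simp only [e, sgn_of_even (show Even (-2 : ℤ) by decide), one_mul] at h
  rw [sum_alternating_add_shift (fun j => zmode X j (zmode X (-2) u v) w), hK (n + N) (by omega),
    smul_zero, sub_zero] at h
  rw [← h]
  simp only [sub_eq_add_neg, Int.cast_neg, Int.cast_ofNat]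

/-- The deformed translation formula: u ∘ 1 plays the role of L(-1)u + L(0)u. -/
theorem zmode_zmode_neg_two_vac (n : ℤ) (u w : V) :
    zmode X n (zmode X (-2) u X.vac) w
      = (-(n : ℂ)) • zmode X (n - 1) u w + (-(n : ℂ) - 1) • zmode X n u w := by
  induction u using isInternal_induction X.deg_internal with
  | hp p u hu =>
    obtain ⟨N₀, h⟩ := zmode_zmode_neg_two X n p 0 hu X.vac_deg w
    rw [h (N₀ + n.natAbs + 2) (by omega)]
    simp only [zmode_vac, mul_zero, sgn_zero, one_smul, apply_ite (zmode X _ u), map_zero]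
    rw [sum_vacuum (fun j => zmode X j u w) n _ (by omega),
      sum_vacuum (fun j => zmode X j u w) (n + 1) _ (by omega), add_sub_cancel_right]
    push_cast
    module
  | hadd x y hx hy =>
    simp only [map_add, LinearMap.add_apply, hx, hy, smul_add]
    abel

theorem zmode_neg_two_mem (u v : V) : zmode X (-2) u v ∈ zhuO X := by
  induction u using isInternal_induction X.wt_internal with
  | hp k u hu => exact Submodule.subset_span ⟨k, u, hu, v, (circ_eq X k hu v).symm⟩
  | hadd x y hx hy => rw [map_add, LinearMap.add_apply]; exact add_mem hx hy

/-- Descending induction on n. The formula for (u ∘ 1)[n]v expresses -n · u[n-1]v through n-th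
modes, and -n = k + 2 is invertible. -/
theorem zmode_mem_zhuO (n : ℤ) (hn : n ≤ -2) (u v : V) : zmode X n u v ∈ zhuO X := by
  obtain ⟨k, rfl⟩ : ∃ k : ℕ, n = -2 - k := ⟨(-2 - n).toNat, by omega⟩
  clear hn
  induction k generalizing u with
  | zero => simpa using zmode_neg_two_mem X u v
  | succ k ih =>
    have h := zmode_zmode_neg_two_vac X (-2 - k) u v
    have h2 : ((k : ℂ) + 2) • zmode X (-2 - k - 1) u v ∈ zhuO X := by
      have h := sub_eq_of_eq_add h
      have e : (k : ℂ) + 2 = -((-2 - k : ℤ) : ℂ) := by push_cast; ring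
      rw [e, ← h]
      exact sub_mem (ih _) (Submodule.smul_mem _ _ (ih _))
    have hne : (k : ℂ) + 2 ≠ 0 := by
      exact_mod_cast (show k + 2 ≠ 0 by omega)
    have h3 := ((zhuO X).smul_mem_iff hne).mp h2
    rwa [Nat.cast_succ, ← sub_sub]

theorem deg_induction₂ {P : V → V → Prop}
    (h : ∀ p q, ∀ u ∈ X.deg p, ∀ v ∈ X.deg q, P u v)
    (hl : ∀ x y v, P x v → P y v → P (x + y) v) (hr : ∀ u x y, P u x → P u y → P u (x + y))
    (u v : V) : P u v := by
  induction u using isInternal_induction X.deg_internal with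
  | hp p u hu =>
    induction v using isInternal_induction X.deg_internal with
    | hp q v hv => exact h p q u hu v hv
    | hadd x y hx hy => exact hr u x y hx hy
  | hadd x y hx hy => exact hl x y v hx hy

theorem zmode_mem_of_left {x : V} (hx : x ∈ zhuO X) (w : V) : zmode X (-1) x w ∈ zhuO X := by
  have key (u v : V) : zmode X (-1) (zmode X (-2) u v) w ∈ zhuO X := by
    refine deg_induction₂ X (P := fun u v => zmode X (-1) (zmode X (-2) u v) w ∈ zhuO X)
      (fun p q u hu v hv => ?_) (fun x y v hx hy => ?_) (fun u x y hx hy => ?_) u v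
    · obtain ⟨N, h⟩ := zmode_zmode_neg_two X (-1) p q hu hv w
      rw [h N le_rfl]
      refine add_mem (Submodule.sum_mem _ fun i _ => Submodule.smul_mem _ _ (sub_mem ?_
        (Submodule.smul_mem _ _ ?_))) (Submodule.sum_mem _ fun i _ => Submodule.smul_mem _ _
          (sub_mem ?_ (Submodule.smul_mem _ _ ?_)))
      -- For n = -1 the outer modes in `zmode_zmode_neg_two` have indices -2-i and -3-i in the first
      -- sum and -2-i in both places of the second.
      all_goals exact zmode_mem_zhuO X _ (by omega) _ _
    · simp only [map_add, LinearMap.add_apply]; exact add_mem hx hy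
    · simp only [map_add, LinearMap.add_apply]; exact add_mem hx hy
  refine (Submodule.span_le (p := (zhuO X).comap ((zmode X (-1)).flip w))).mpr ?_ hx
  rintro _ ⟨k, u, hu, v, rfl⟩
  rw [circ_eq X k hu]
  exact key u v

theorem zmode_mem_of_right (u : V) {x : V} (hx : x ∈ zhuO X) : zmode X (-1) u x ∈ zhuO X := by
  have key (u v w : V) : zmode X (-1) u (zmode X (-2) v w) ∈ zhuO X := by
    refine deg_induction₂ X (P := fun u v => zmode X (-1) u (zmode X (-2) v w) ∈ zhuO X)
      (fun p q u hu v hv => ?_) (fun x y v hx hy => ?_) (fun u x y hx hy => ?_) u v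
    · obtain ⟨N, h⟩ := zmode_comm X (-1) (-2) p q hu hv w
      rw [sub_eq_iff_eq_add.mp (h N le_rfl)]
      refine add_mem (Submodule.sum_mem _ fun t _ => Submodule.sum_mem _ fun j _ => ?_)
        (Submodule.smul_mem _ _ (zmode_mem_zhuO X _ (by omega) _ _))
      by_cases hj : j ≤ t + 1
      · exact Submodule.smul_mem _ _ (zmode_mem_zhuO X _ (by omega) _ _)
      · rw [Nat.choose_eq_zero_of_lt (not_le.mp hj), Nat.cast_zero, mul_zero, zero_smul]
        exact zero_mem _
    · simp only [map_add, LinearMap.add_apply]; exact add_mem hx hy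
    · simp only [map_add, LinearMap.add_apply]; exact add_mem hx hy
  refine (Submodule.span_le (p := (zhuO X).comap (zmode X (-1) u))).mpr ?_ hx
  rintro _ ⟨k, v, hv, w, rfl⟩
  rw [circ_eq X k hv]
  exact key u v w

theorem zmode_neg_one_assoc (u v w : V) :
    zmode X (-1) (zmode X (-1) u v) w - zmode X (-1) u (zmode X (-1) v w) ∈ zhuO X := by
  refine deg_induction₂ X (P := fun u v => zmode X (-1) (zmode X (-1) u v) w
    - zmode X (-1) u (zmode X (-1) v w) ∈ zhuO X)
    (fun p q u hu v hv => ?_) (fun x y v hx hy => ?_) (fun u x y hx hy => ?_) u v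
  · obtain ⟨N, h⟩ := zmode_assoc X (-1) (-1) p q hu hv w
    have h := h (N + 1) (by omega)
    rw [Finset.sum_range_succ', Finset.sum_eq_single_of_mem (s := Finset.range (N + 1)) 0
      (Finset.mem_range.mpr (by omega)) (fun t _ ht => by
        rw [Int.cast_neg, Int.cast_one, neg_add_cancel, bin_zero_left, if_neg ht, zero_smul])] at h
    simp only [bin_zero_right, Nat.cast_zero, add_zero, sub_zero, pow_zero, one_mul, one_smul] at h
    rw [← h, ← add_sub_assoc, sub_right_comm, add_sub_cancel_right]
    refine sub_mem (Submodule.sum_mem _ fun i _ => Submodule.smul_mem _ _ (sub_mem ?_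
        (Submodule.smul_mem _ _ ?_))) (Submodule.smul_mem _ _ ?_)
    all_goals exact zmode_mem_zhuO X _ (by omega) _ _
  · simp only [map_add, LinearMap.add_apply, add_sub_add_comm]; exact add_mem hx hy
  · simp only [map_add, LinearMap.add_apply, add_sub_add_comm]; exact add_mem hx hy

/-- The commutator formula in the Zhu algebra. -/
theorem zmode_neg_one_comm (p q : ℤ) {u v : V} (hu : u ∈ X.deg p) (hv : v ∈ X.deg q) :
    ∃ N : ℕ, zmode X (-1) u v - sgn (p * q) • zmode X (-1) v u
      - ∑ t ∈ Finset.range N, (-1 : ℂ) ^ t • zmode X t u v ∈ zhuO X := by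
  obtain ⟨N, h⟩ := zmode_comm X (-1) (-1) p q hu hv X.vac
  obtain ⟨K, hK⟩ := zmode_truncation X u v
  -- The extra 1 keeps j = t + 1 inside the range for all t but the last, and there u[t]v = 0 by the
  -- choice of K.
  refine ⟨N + K.toNat + 1, ?_⟩
  have h := h (N + K.toNat + 1) (by omega)
  simp only [zmode_neg_one_vac] at h
  rw [h, ← Finset.sum_sub_distrib]
  refine Submodule.sum_mem _ fun t _ => ?_
  by_cases ht : t < N + K.toNat
  -- The term j = t + 1 is (u[t]v)[-1] applied to the vacuum, that is u[t]v, with coefficient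
  -- (-1)^t. The terms with j ≤ t lie in O(V).
  · rw [← Finset.add_sum_erase _ _ (Finset.mem_range.mpr (Nat.succ_lt_succ ht)), Nat.choose_self,
      show (-1 + -1 - t + ((t + 1 : ℕ) : ℤ) : ℤ) = -1 by push_cast; ring, zmode_neg_one_vac,
      Int.cast_neg, Int.cast_one, bin_neg_one, Nat.cast_one, mul_one, add_sub_cancel_left]
    refine Submodule.sum_mem _ fun j hj => ?_
    have hj := Finset.ne_of_mem_erase hj
    by_cases hjt : j < t + 1
    · exact Submodule.smul_mem _ _ (zmode_mem_zhuO X _ (by omega) _ _)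
    · rw [Nat.choose_eq_zero_of_lt (by omega), Nat.cast_zero, mul_zero, zero_smul]
      exact zero_mem _
  · simp [hK t (by omega)]

end

/-! ### Filtered superalgebras -/

section FilteredSuperalgebra

variable {A : Type u} [AddCommGroup A] [Module ℂ A]

/-- The supercommutator of a product, for the parity involution `par`. -/
noncomputable def superComm (mul : A →ₗ[ℂ] A →ₗ[ℂ] A) (par : A →ₗ[ℂ] A) : A →ₗ[ℂ] A →ₗ[ℂ] A :=
  mul - (1 / 2 : ℂ) • (mul.flip + mul.flip.compl₂ par + mul.flip.comp par
    - mul.flip.compl₁₂ par par)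

theorem superComm_apply (mul : A →ₗ[ℂ] A →ₗ[ℂ] A) (par : A →ₗ[ℂ] A) (x y : A) :
    superComm mul par x y = mul x y
      - (1 / 2 : ℂ) • (mul y x + mul (par y) x + mul y (par x) - mul (par y) (par x)) := rfl

/-- For signs ε = (-1)^p and η = (-1)^q the number (1 + ε + η - εη)/2 equals (-1)^(pq). The Koszul
sign thus becomes bilinear, and the supercommutator is defined on all of A without a grading. -/
theorem superComm_of_par {mul : A →ₗ[ℂ] A →ₗ[ℂ] A} {par : A →ₗ[ℂ] A} {p q : ℤ} {x y : A}
    (hx : par x = sgn p • x) (hy : par y = sgn q • y) :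
    superComm mul par x y = mul x y - sgn (p * q) • mul y x := by
  rw [superComm_apply, hx, hy]
  simp only [map_smul, LinearMap.smul_apply]
  rcases Int.even_or_odd p with h | h
  · rw [sgn_of_even h, sgn_of_even (h.mul_right q)]
    module
  · rcases Int.even_or_odd q with h' | h'
    · rw [sgn_of_even h', sgn_of_even (h'.mul_left p)]
      module
    · rw [sgn_of_odd h, sgn_of_odd h', sgn_of_odd (h.mul h')]
      module

/-- An associative superalgebra with an odd differential and two multiplicative filtrations, such
that the parity on `F p / F (p - 1)` is that of `p` and the supercommutator lowers both filtrations
by two. -/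
structure FilteredSuperalgebra (F W : ℤ → Submodule ℂ A) where
  mul : A →ₗ[ℂ] A →ₗ[ℂ] A
  one : A
  d : A →ₗ[ℂ] A
  par : A →ₗ[ℂ] A
  F_mono : ∀ p, F (p - 1) ≤ F p
  W_mono : ∀ k, W (k - 1) ≤ W k
  mul_assoc : ∀ x y z, mul (mul x y) z = mul x (mul y z)
  one_mul : ∀ x, mul one x = x
  mul_one : ∀ x, mul x one = x
  d_d : ∀ x, d (d x) = 0
  d_mul : ∀ x y, d (mul x y) = mul (d x) y + mul (par x) (d y)
  par_par : ∀ x, par (par x) = x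
  par_mul : ∀ x y, par (mul x y) = mul (par x) (par y)
  par_d : ∀ x, par (d x) = - d (par x)
  one_F : one ∈ F 0
  one_W : one ∈ W 0
  mul_F : ∀ p q, ∀ x ∈ F p, ∀ y ∈ F q, mul x y ∈ F (p + q)
  mul_W : ∀ k l, ∀ x ∈ W k, ∀ y ∈ W l, mul x y ∈ W (k + l)
  d_F : ∀ p, ∀ x ∈ F p, d x ∈ F (p + 1)
  d_W : ∀ k, ∀ x ∈ W k, d x ∈ W k
  par_F : ∀ p, ∀ x ∈ F p, x - sgn p • par x ∈ F (p - 1)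
  par_W : ∀ k, ∀ x ∈ W k, par x ∈ W k
  comm_F : ∀ p q, ∀ x ∈ F p, ∀ y ∈ F q, superComm mul par x y ∈ F (p + q - 2)
  comm_W : ∀ k l, ∀ x ∈ W k, ∀ y ∈ W l, superComm mul par x y ∈ W (k + l - 2)

end FilteredSuperalgebra

section

variable {V : Type u} [AddCommGroup V] [Module ℂ V] (X : DGVertexOperatorAlgebra V)

/-! ### The Zhu algebra -/

theorem exists_parity : ∃ g : V →ₗ[ℂ] V, ∀ p, ∀ v ∈ X.deg p, g v = sgn p • v :=
  exists_linearMap_of_isInternal X.deg_internal fun p => sgn p • LinearMap.id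

/-- The parity involution, `(-1)^p` in degree `p`. -/
noncomputable def parity : V →ₗ[ℂ] V := (exists_parity X).choose

theorem parity_apply {p : ℤ} {v : V} (hv : v ∈ X.deg p) : parity X v = sgn p • v :=
  (exists_parity X).choose_spec p v hv

theorem parity_parity (v : V) : parity X (parity X v) = v := by
  induction v using isInternal_induction X.deg_internal with
  | hp p v hv => rw [parity_apply X hv, map_smul, parity_apply X hv, smul_smul, sgn_mul_self,
      one_smul]
  | hadd x y hx hy => rw [map_add, map_add, hx, hy]

theorem parity_d (v : V) : parity X (X.d v) = - X.d (parity X v) := by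
  induction v using isInternal_induction X.deg_internal with
  | hp p v hv =>
    rw [parity_apply X hv, parity_apply X (X.d_deg p v hv), map_smul, sgn_add,
      sgn_of_odd odd_one, mul_neg_one, neg_smul]
  | hadd x y hx hy => rw [map_add, map_add, map_add, map_add, hx, hy, neg_add]

theorem parity_wt {k : ℤ} {v : V} (hv : v ∈ wtSpace X k) : parity X v ∈ wtSpace X k := by
  refine wt_homogeneous_induction X (P := fun v => parity X v ∈ wtSpace X k)
    (fun p v hp hv => ?_) (fun x y hx hy => ?_) v hv
  · rw [parity_apply X hp]
    exact Submodule.smul_mem _ _ hv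
  · rw [map_add]
    exact add_mem hx hy

theorem homogeneous_induction₂ {P : V → V → Prop}
    (h : ∀ p q k, ∀ u ∈ X.deg p, u ∈ wtSpace X k → ∀ v ∈ X.deg q, P u v)
    (hl : ∀ x y v, P x v → P y v → P (x + y) v) (hr : ∀ u x y, P u x → P u y → P u (x + y))
    (u v : V) : P u v := by
  refine deg_induction₂ X (fun p q u hu v hv => ?_) hl hr u v
  exact deg_homogeneous_induction X (P := fun u => P u v)
    (fun k u hp hk => h p q k u hp hk v hv) (fun x y => hl x y v) u hu

/-- The components of u[n]v have different degrees, but all of the parity of p + q. This is why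
parity, unlike degree, descends to A(V). -/
theorem parity_zmode (n : ℤ) (u v : V) :
    parity X (zmode X n u v) = zmode X n (parity X u) (parity X v) := by
  refine homogeneous_induction₂ X (P := fun u v => parity X (zmode X n u v)
    = zmode X n (parity X u) (parity X v)) (fun p q k u hu hk v hv => ?_) ?_ ?_ u v
  · have h := zmode_mem X (fun n => X.mode_deg n p q u hu v hv) n k hk
    rw [parity_apply X hu, parity_apply X hv, map_smul, map_smul, LinearMap.smul_apply, smul_smul,
      ← sgn_add]
    have key : ⨆ r : ℤ, ⨆ _ : Even (p + q - r) ∧ r ≤ p + q - 2 * n - 2, X.deg r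
        ≤ LinearMap.eqLocus (parity X) (sgn (q + p) • LinearMap.id) := ?_
    · exact key h
    refine iSup₂_le ?_
    rintro r ⟨hr, -⟩ w hw
    rw [LinearMap.mem_eqLocus, parity_apply X hw, LinearMap.smul_apply, LinearMap.id_apply]
    have e : sgn (p + q - r) = 1 := sgn_of_even hr
    rw [show q + p = p + q - r + r by ring, sgn_add, e, one_mul]
  · intro x y v hx hy
    simp only [map_add, LinearMap.add_apply, hx, hy]
  · intro u x y hx hy
    simp only [map_add, hx, hy]

theorem d_zmode_eq_parity (n : ℤ) (u v : V) :
    X.d (zmode X n u v) = zmode X n (X.d u) v + zmode X n (parity X u) (X.d v) := by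
  induction u using isInternal_induction X.deg_internal with
  | hp p u hu => rw [d_zmode X n p u hu, parity_apply X hu, map_smul, LinearMap.smul_apply]
  | hadd x y hx hy =>
    simp only [map_add, LinearMap.add_apply, hx, hy]
    abel

theorem zhuO_le_comap_parity : zhuO X ≤ (zhuO X).comap (parity X) := by
  refine Submodule.span_le.mpr ?_
  rintro _ ⟨k, u, hu, v, rfl⟩
  rw [circ_eq X k hu, SetLike.mem_coe, Submodule.mem_comap, parity_zmode]
  exact zmode_neg_two_mem X _ _

theorem zhuO_le_comap_d : zhuO X ≤ (zhuO X).comap X.d := by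
  refine Submodule.span_le.mpr ?_
  rintro _ ⟨k, u, hu, v, rfl⟩
  rw [circ_eq X k hu, SetLike.mem_coe, Submodule.mem_comap, d_zmode_eq_parity]
  exact add_mem (zmode_neg_two_mem X _ _) (zmode_neg_two_mem X _ _)

noncomputable def zhuParity : ZhuA X →ₗ[ℂ] ZhuA X :=
  (zhuO X).mapQ (zhuO X) (parity X) (zhuO_le_comap_parity X)

noncomputable def zhuD : ZhuA X →ₗ[ℂ] ZhuA X :=
  (zhuO X).mapQ (zhuO X) X.d (zhuO_le_comap_d X)

noncomputable def zhuMulAux : ZhuA X →ₗ[ℂ] V →ₗ[ℂ] ZhuA X :=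
  (zhuO X).liftQ ((zmode X (-1)).compr₂ (zhuO X).mkQ) fun x hx => by
    rw [LinearMap.mem_ker]
    ext w
    exact (Submodule.Quotient.mk_eq_zero _).mpr (zmode_mem_of_left X hx w)

noncomputable def zhuMul : ZhuA X →ₗ[ℂ] ZhuA X →ₗ[ℂ] ZhuA X :=
  ((zhuO X).liftQ (zhuMulAux X).flip fun x hx => by
    rw [LinearMap.mem_ker]
    refine LinearMap.ext fun y => ?_
    induction y using Submodule.Quotient.induction_on with
    | _ u => exact (Submodule.Quotient.mk_eq_zero _).mpr (zmode_mem_of_right X u hx)).flip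

theorem zhuMul_cls (u v : V) : zhuMul X (cls X u) (cls X v) = cls X (zmode X (-1) u v) := rfl

theorem zhuParity_cls (v : V) : zhuParity X (cls X v) = cls X (parity X v) := rfl

theorem zhuD_cls (v : V) : zhuD X (cls X v) = cls X (X.d v) := rfl

theorem cls_surjective : Function.Surjective (cls X) := (zhuO X).mkQ_surjective

theorem cls_add (u v : V) : cls X (u + v) = cls X u + cls X v := map_add _ u v

theorem cls_sub (u v : V) : cls X (u - v) = cls X u - cls X v := map_sub _ u v

theorem cls_smul (c : ℂ) (v : V) : cls X (c • v) = c • cls X v := map_smul _ c v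

theorem cls_eq_zero {v : V} : cls X v = 0 ↔ v ∈ zhuO X := Submodule.Quotient.mk_eq_zero _

/-- Only modes with t ≥ 0 appear, and each of them lowers degree and doubled weight by at least two.
Hence the bidegree of the bracket. -/
theorem superComm_cls (p q : ℤ) {u v : V} (hu : u ∈ X.deg p) (hv : v ∈ X.deg q) :
    ∃ N : ℕ, superComm (zhuMul X) (zhuParity X) (cls X u) (cls X v)
      = cls X (∑ t ∈ Finset.range N, (-1 : ℂ) ^ t • zmode X t u v) := by
  obtain ⟨N, h⟩ := zmode_neg_one_comm X p q hu hv
  refine ⟨N, ?_⟩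
  rw [superComm_of_par (p := p) (q := q), zhuMul_cls, zhuMul_cls, ← cls_smul, ← cls_sub,
    ← sub_eq_zero, ← cls_sub, cls_eq_zero]
  · exact h
  · rw [zhuParity_cls, parity_apply X hu, cls_smul]
  · rw [zhuParity_cls, parity_apply X hv, cls_smul]

/-! ### The filtrations of the Zhu algebra -/

/-- A grading of `V` by subspaces that are spanned by vectors homogeneous for degree and weight,
such that the `n`-th mode has degree `-2 n - 2`. -/
structure IsModeGrading (M : ℤ → Submodule ℂ V) : Prop where
  mode_mem : ∀ n p q, ∀ u ∈ M p, ∀ v ∈ M q, X.mode n u v ∈ M (p + q - 2 * n - 2)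
  induction : ∀ (r : ℤ) (P : V → Prop), (∀ p k, ∀ v ∈ M r, v ∈ X.deg p → v ∈ wtSpace X k → P v) →
    (∀ x y, P x → P y → P (x + y)) → ∀ v ∈ M r, P v

theorem isModeGrading_deg : IsModeGrading X X.deg where
  mode_mem n p q u hu v hv := X.mode_deg n p q u hu v hv
  induction r _ h hadd v hv :=
    deg_homogeneous_induction X (fun k v hp hk => h r k v hp hp hk) hadd v hv

theorem isModeGrading_wtSpace : IsModeGrading X (wtSpace X) where
  mode_mem n k l u hu v hv := mode_wt X n k l u hu v hv
  induction r _ h hadd v hv :=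
    wt_homogeneous_induction X (fun p v hp hk => h p r v hk hp hk) hadd v hv

/-- The image in the Zhu algebra of the components of index at most `p`. -/
noncomputable def zhuFil (M : ℤ → Submodule ℂ V) (p : ℤ) : Submodule ℂ (ZhuA X) :=
  (⨆ q : ℤ, ⨆ _ : q ≤ p, M q).map (zhuO X).mkQ

variable {X} {M : ℤ → Submodule ℂ V}

theorem cls_mem_zhuFil {p q : ℤ} (h : q ≤ p) {v : V} (hv : v ∈ M q) : cls X v ∈ zhuFil X M p :=
  Submodule.mem_map_of_mem (Submodule.mem_iSup_of_mem q (Submodule.mem_iSup_of_mem h hv))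

theorem zhuFil_mono {p q : ℤ} (h : q ≤ p) : zhuFil X M q ≤ zhuFil X M p :=
  Submodule.map_mono (iSup₂_le fun r hr => le_iSup₂_of_le r (hr.trans h) le_rfl)

theorem zhuFil_le {p : ℤ} {S : Submodule ℂ (ZhuA X)} (h : ∀ q ≤ p, ∀ v ∈ M q, cls X v ∈ S) :
    zhuFil X M p ≤ S :=
  Submodule.map_le_iff_le_comap.mpr (iSup₂_le fun q hq v hv => h q hq v hv)

theorem IsModeGrading.zhuFil_le (hM : IsModeGrading X M) {p : ℤ} {S : Submodule ℂ (ZhuA X)}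
    (h : ∀ q ≤ p, ∀ r k, ∀ v ∈ M q, v ∈ X.deg r → v ∈ wtSpace X k → cls X v ∈ S) :
    zhuFil X M p ≤ S :=
  DGVertex.zhuFil_le fun q hq v hv => hM.induction q (fun v => cls X v ∈ S)
    (fun r k v hv hr hk => h q hq r k v hv hr hk)
    (fun x y hx hy => by rw [cls_add]; exact add_mem hx hy) v hv

theorem IsModeGrading.cls_zmode_mem (hM : IsModeGrading X M) {p q k : ℤ} (n : ℤ) {u v : V}
    (hu : u ∈ M p) (hk : u ∈ wtSpace X k) (hv : v ∈ M q) :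
    cls X (zmode X n u v) ∈ zhuFil X M (p + q - 2 * n - 2) := by
  have h := zmode_mem X (fun n => hM.mode_mem n p q u hu v hv) n k hk
  have key : ⨆ r : ℤ, ⨆ _ : Even (p + q - r) ∧ r ≤ p + q - 2 * n - 2, M r
      ≤ ⨆ r : ℤ, ⨆ _ : r ≤ p + q - 2 * n - 2, M r :=
    iSup₂_le fun r hr => le_iSup₂_of_le r hr.2 le_rfl
  exact Submodule.mem_map_of_mem (key h)

theorem IsModeGrading.bilinear_mem (hM : IsModeGrading X M) (B : ZhuA X →ₗ[ℂ] ZhuA X →ₗ[ℂ] ZhuA X)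
    {p q : ℤ} {S : Submodule ℂ (ZhuA X)}
    (h : ∀ p' q' r s k, p' ≤ p → q' ≤ q → ∀ u ∈ M p', u ∈ X.deg r → u ∈ wtSpace X k →
      ∀ v ∈ M q', v ∈ X.deg s → B (cls X u) (cls X v) ∈ S) :
    ∀ x ∈ zhuFil X M p, ∀ y ∈ zhuFil X M q, B x y ∈ S := by
  intro x hx y hy
  refine hM.zhuFil_le (S := S.comap (B.flip y)) (fun p' hp' r k u hu hr hk => ?_) hx
  refine hM.zhuFil_le (S := S.comap (B (cls X u))) (fun q' hq' s _ v hv hs _ => ?_) hy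
  exact h p' q' r s k hp' hq' u hu hr hk v hv hs

theorem IsModeGrading.zhuMul_mem (hM : IsModeGrading X M) (p q : ℤ) :
    ∀ x ∈ zhuFil X M p, ∀ y ∈ zhuFil X M q, zhuMul X x y ∈ zhuFil X M (p + q) :=
  hM.bilinear_mem _ fun p' q' _ _ _ hp hq u hu _ hk v hv _ =>
    zhuFil_mono (by omega) (hM.cls_zmode_mem (-1) hu hk hv)

theorem IsModeGrading.superComm_mem (hM : IsModeGrading X M) (p q : ℤ) :
    ∀ x ∈ zhuFil X M p, ∀ y ∈ zhuFil X M q,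
      superComm (zhuMul X) (zhuParity X) x y ∈ zhuFil X M (p + q - 2) :=
  hM.bilinear_mem _ fun p' q' r s k hp hq u hu hr hk v hv hs => by
    obtain ⟨N, h⟩ := superComm_cls X r s hr hs
    rw [h]
    refine (Submodule.sum_mem ((zhuFil X M (p + q - 2)).comap (zhuO X).mkQ) fun t _ =>
      Submodule.smul_mem _ _ ?_ : _ ∈ _)
    exact zhuFil_mono (by omega) (hM.cls_zmode_mem t hu hk hv)

variable (X)

/-- The Zhu algebra with its two filtrations. -/
noncomputable def zhuSuperalgebra : FilteredSuperalgebra (filF X) (filW X) where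
  mul := zhuMul X
  one := cls X X.vac
  d := zhuD X
  par := zhuParity X
  F_mono p := zhuFil_mono (M := X.deg) (by omega)
  W_mono k := zhuFil_mono (M := wtSpace X) (by omega)
  mul_assoc x y z := by
    obtain ⟨u, rfl⟩ := cls_surjective X x
    obtain ⟨v, rfl⟩ := cls_surjective X y
    obtain ⟨w, rfl⟩ := cls_surjective X z
    simp only [zhuMul_cls]
    rw [← sub_eq_zero, ← cls_sub, cls_eq_zero]
    exact zmode_neg_one_assoc X u v w
  one_mul x := by
    obtain ⟨u, rfl⟩ := cls_surjective X x
    rw [zhuMul_cls, zmode_vac, if_pos rfl]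
  mul_one x := by
    obtain ⟨u, rfl⟩ := cls_surjective X x
    rw [zhuMul_cls, zmode_neg_one_vac]
  d_d x := by
    obtain ⟨u, rfl⟩ := cls_surjective X x
    rw [zhuD_cls, zhuD_cls, X.d_d]
    exact map_zero _
  d_mul x y := by
    obtain ⟨u, rfl⟩ := cls_surjective X x
    obtain ⟨v, rfl⟩ := cls_surjective X y
    simp only [zhuMul_cls, zhuD_cls, zhuParity_cls, d_zmode_eq_parity, cls_add]
  par_par x := by
    obtain ⟨u, rfl⟩ := cls_surjective X x
    rw [zhuParity_cls, zhuParity_cls, parity_parity]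
  par_mul x y := by
    obtain ⟨u, rfl⟩ := cls_surjective X x
    obtain ⟨v, rfl⟩ := cls_surjective X y
    simp only [zhuMul_cls, zhuParity_cls, parity_zmode]
  par_d x := by
    obtain ⟨u, rfl⟩ := cls_surjective X x
    rw [zhuD_cls, zhuParity_cls, zhuParity_cls, zhuD_cls, parity_d]
    exact map_neg _ _
  one_F := cls_mem_zhuFil (M := X.deg) le_rfl X.vac_deg
  one_W := cls_mem_zhuFil (M := wtSpace X) le_rfl (vac_wt X)
  mul_F := (isModeGrading_deg X).zhuMul_mem
  mul_W := (isModeGrading_wtSpace X).zhuMul_mem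
  d_F p x hx := zhuFil_le (M := X.deg) (S := (filF X (p + 1)).comap (zhuD X))
    (fun q hq v hv => cls_mem_zhuFil (M := X.deg) (by omega : q + 1 ≤ p + 1) (X.d_deg q v hv)) hx
  d_W k x hx := zhuFil_le (M := wtSpace X) (S := (filW X k).comap (zhuD X))
    (fun q hq v hv => cls_mem_zhuFil (M := wtSpace X) hq (d_wt X q v hv)) hx
  par_F p x hx := by
    have h := zhuFil_le (M := X.deg)
      (S := (filF X (p - 1)).comap (LinearMap.id - sgn p • zhuParity X)) (fun q hq v hv => ?_) hx
    · exact h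
    · rw [Submodule.mem_comap, LinearMap.sub_apply, LinearMap.smul_apply, zhuParity_cls,
        parity_apply X hv, cls_smul, smul_smul, LinearMap.id_apply]
      -- In the top degree q = p the two signs cancel exactly; the lower degrees already lie in
      -- F^(p-1).
      rcases hq.eq_or_lt with rfl | hlt
      · rw [sgn_mul_self, one_smul, sub_self]
        exact zero_mem _
      · have h := cls_mem_zhuFil (X := X) (M := X.deg) (by omega : q ≤ p - 1) hv
        exact sub_mem h (Submodule.smul_mem _ _ h)
  par_W k x hx := zhuFil_le (M := wtSpace X) (S := (filW X k).comap (zhuParity X))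
    (fun q hq v hv => cls_mem_zhuFil (M := wtSpace X) hq (parity_wt X hv)) hx
  comm_F := (isModeGrading_deg X).superComm_mem
  comm_W := (isModeGrading_wtSpace X).superComm_mem

noncomputable def zhuStructure : ZhuStructure X where
  mul := zhuMul X
  d := zhuD X
  mul_cls k u hu v := by rw [star_eq X k hu, zhuMul_cls]
  d_cls v := rfl
  mul_assoc := (zhuSuperalgebra X).mul_assoc
  one_mul := (zhuSuperalgebra X).one_mul
  mul_one := (zhuSuperalgebra X).mul_one
  mul_filF := (zhuSuperalgebra X).mul_F
  mul_filW := (zhuSuperalgebra X).mul_W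
  d_filF := (zhuSuperalgebra X).d_F
  d_filW := (zhuSuperalgebra X).d_W

end

/-! ### Classes in the doubly graded space -/

theorem isInternal_range_lof {ι : Type} [DecidableEq ι] (β : ι → Type u)
    [∀ i, AddCommGroup (β i)] [∀ i, Module ℂ (β i)] :
    DirectSum.IsInternal fun i => LinearMap.range (DirectSum.lof ℂ ι β i) := by
  let c := DirectSum.coeLinearMap fun i => LinearMap.range (DirectSum.lof ℂ ι β i)
  let g : (⨁ i, β i) →ₗ[ℂ] ⨁ i, LinearMap.range (DirectSum.lof ℂ ι β i) :=
    DirectSum.toModule ℂ ι _ fun i =>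
      (DirectSum.lof ℂ ι (fun i => ↥(LinearMap.range (DirectSum.lof ℂ ι β i))) i).comp
        (DirectSum.lof ℂ ι β i).rangeRestrict
  have h : g.comp c = LinearMap.id := by
    refine DirectSum.linearMap_ext ℂ fun i => LinearMap.ext ?_
    rintro ⟨_, w, rfl⟩
    rw [LinearMap.comp_apply, LinearMap.comp_apply, DirectSum.coeLinearMap_lof,
      DirectSum.toModule_lof]
    rfl
  have h' : c.comp g = LinearMap.id := by
    refine DirectSum.linearMap_ext ℂ fun i => LinearMap.ext fun w => ?_
    rw [LinearMap.comp_apply, LinearMap.comp_apply, DirectSum.toModule_lof, LinearMap.comp_apply,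
      DirectSum.coeLinearMap_lof]
    rfl
  exact ⟨Function.LeftInverse.injective (g := g) (LinearMap.congr_fun h),
    Function.RightInverse.surjective (g := g) (LinearMap.congr_fun h')⟩

section GrGr

variable {M : Type u} [AddCommGroup M] [Module ℂ M] (F G : ℤ → Submodule ℂ M)

/-- The class in the component of index `(p, n)`, as a linear map. -/
noncomputable def componentMap (p n : ℤ) : ↥(F p ⊓ G n) →ₗ[ℂ] Gr (inducedFil F G p) n where
  toFun x := Submodule.Quotient.mk (toInducedFil F G p n x.1 x.2.1 x.2.2)
  map_add' _ _ := rfl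
  map_smul' _ _ := rfl

noncomputable def symbolMap (p n : ℤ) : ↥(F p ⊓ G n) →ₗ[ℂ] GrGr F G :=
  (GrGr.incl F G p n).comp (componentMap F G p n)

theorem componentMap_surjective (p n : ℤ) : Function.Surjective (componentMap F G p n) := by
  intro z
  obtain ⟨⟨z, hz⟩, rfl⟩ := Submodule.Quotient.mk_surjective _ z
  obtain ⟨⟨x, hF⟩, hG, rfl⟩ := Submodule.mem_map.mp hz
  exact ⟨⟨x, hF, hG⟩, rfl⟩

theorem incl_injective (p n : ℤ) : Function.Injective (GrGr.incl F G p n) :=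
  DirectSum.of_injective (β := fun i : ℤ × ℤ => Gr (inducedFil F G i.1) i.2) (p, n)

variable {F G}

theorem symbolMap_apply {p n : ℤ} (x : ↥(F p ⊓ G n)) :
    symbolMap F G p n x = GrGr.symbol F G p n x.1 x.2.1 x.2.2 := rfl

theorem componentMap_eq_zero {p n : ℤ} {x : ↥(F p ⊓ G n)} :
    componentMap F G p n x = 0 ↔ ∃ y ∈ F p ⊓ G (n - 1), (x : M) - y ∈ F (p - 1) := by
  change Submodule.Quotient.mk _ = 0 ↔ _
  rw [Submodule.Quotient.mk_eq_zero]
  constructor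
  · rintro ⟨⟨y, hF⟩, hG, h⟩
    refine ⟨y, ⟨hF, hG⟩, ?_⟩
    exact (Submodule.Quotient.eq ((F (p - 1)).submoduleOf (F p)) (x := ⟨x, x.2.1⟩)
      (y := ⟨y, hF⟩)).mp h.symm
  · rintro ⟨y, ⟨hF, hG⟩, h⟩
    exact ⟨⟨y, hF⟩, hG, ((Submodule.Quotient.eq ((F (p - 1)).submoduleOf (F p))
      (x := ⟨x, x.2.1⟩) (y := ⟨y, hF⟩)).mpr h).symm⟩

/-- This description of the kernel is all that is needed to check that an operation is well defined
on classes. -/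
theorem symbolMap_eq_zero {p n : ℤ} {x : ↥(F p ⊓ G n)} :
    symbolMap F G p n x = 0 ↔ ∃ y ∈ F p ⊓ G (n - 1), (x : M) - y ∈ F (p - 1) := by
  rw [← componentMap_eq_zero, symbolMap, LinearMap.comp_apply,
    map_eq_zero_iff _ (incl_injective F G p n)]

theorem symbol_linear {p n p₁ n₁ p₂ n₂ : ℤ} {x y z : M} {a b : ℂ}
    {hF : x ∈ F p} {hG : x ∈ G n} {hF₁ : y ∈ F p₁} {hG₁ : y ∈ G n₁} {hF₂ : z ∈ F p₂}
    {hG₂ : z ∈ G n₂} (hp₁ : p₁ = p) (hn₁ : n₁ = n) (hp₂ : p₂ = p) (hn₂ : n₂ = n)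
    (h : x = a • y + b • z) :
    GrGr.symbol F G p n x hF hG
      = a • GrGr.symbol F G p₁ n₁ y hF₁ hG₁ + b • GrGr.symbol F G p₂ n₂ z hF₂ hG₂ := by
  subst hp₁ hn₁ hp₂ hn₂ h
  have e := map_add (symbolMap F G p₂ n₂) (a • ⟨y, hF₁, hG₁⟩) (b • ⟨z, hF₂, hG₂⟩)
  rwa [map_smul, map_smul] at e

theorem symbol_smul {p n p₁ n₁ : ℤ} {x y : M} {a : ℂ}
    {hF : x ∈ F p} {hG : x ∈ G n} {hF₁ : y ∈ F p₁} {hG₁ : y ∈ G n₁} (hp₁ : p₁ = p) (hn₁ : n₁ = n)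
    (h : x = a • y) :
    GrGr.symbol F G p n x hF hG = a • GrGr.symbol F G p₁ n₁ y hF₁ hG₁ := by
  subst hp₁ hn₁ h
  exact map_smul (symbolMap F G p₁ n₁) a ⟨y, hF₁, hG₁⟩

theorem symbol_congr {p n p₁ n₁ : ℤ} {x y : M}
    {hF : x ∈ F p} {hG : x ∈ G n} {hF₁ : y ∈ F p₁} {hG₁ : y ∈ G n₁} (hp₁ : p₁ = p) (hn₁ : n₁ = n)
    (h : x = y) :
    GrGr.symbol F G p n x hF hG = GrGr.symbol F G p₁ n₁ y hF₁ hG₁ := by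
  subst hp₁ hn₁ h
  rfl

theorem symbol_eq_symbol {p n : ℤ} {x y : M} {hF : x ∈ F p} {hG : x ∈ G n} {hF₁ : y ∈ F p}
    {hG₁ : y ∈ G n} (h : x - y ∈ F (p - 1)) :
    GrGr.symbol F G p n x hF hG = GrGr.symbol F G p n y hF₁ hG₁ := by
  have e : symbolMap F G p n (⟨x, hF, hG⟩ - ⟨y, hF₁, hG₁⟩) = 0 :=
    symbolMap_eq_zero.mpr ⟨0, zero_mem _, by simpa using h⟩
  rwa [map_sub, sub_eq_zero] at e

theorem symbol_mem_piece {p n : ℤ} {x : M} (hF : x ∈ F p) (hG : x ∈ G n) :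
    GrGr.symbol F G p n x hF hG ∈ GrGr.piece F G p n :=
  ⟨_, rfl⟩

theorem exists_symbol {p n : ℤ} {z : GrGr F G} (hz : z ∈ GrGr.piece F G p n) :
    ∃ (x : M) (hF : x ∈ F p) (hG : x ∈ G n), z = GrGr.symbol F G p n x hF hG := by
  obtain ⟨w, rfl⟩ := hz
  obtain ⟨x, rfl⟩ := componentMap_surjective F G p n w
  exact ⟨x.1, x.2.1, x.2.2, rfl⟩

theorem piece_induction {P : GrGr F G → Prop} (h : ∀ p n, ∀ z ∈ GrGr.piece F G p n, P z)
    (hadd : ∀ x y, P x → P y → P (x + y)) (z : GrGr F G) : P z :=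
  DirectSum.induction_on (β := fun i : ℤ × ℤ => Gr (inducedFil F G i.1) i.2) (motive := P) z
    (h 0 0 _ (zero_mem _)) (fun i w => h i.1 i.2 _ ⟨w, rfl⟩) hadd

theorem isInternal_piece :
    DirectSum.IsInternal fun i : ℤ × ℤ => GrGr.piece F G i.1 i.2 :=
  isInternal_range_lof fun i : ℤ × ℤ => Gr (inducedFil F G i.1) i.2

/-- Each component is the quotient of F_p ∩ G_n by the kernel of the class map, so a map that kills
this kernel descends. A linear section of the class map supplies the values. -/
theorem exists_lift {N : Type u} [AddCommGroup N] [Module ℂ N]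
    (T : ∀ p n, ↥(F p ⊓ G n) →ₗ[ℂ] N) (hT : ∀ p n x, symbolMap F G p n x = 0 → T p n x = 0) :
    ∃ f : GrGr F G →ₗ[ℂ] N, ∀ p n x, f (symbolMap F G p n x) = T p n x := by
  choose s hs using fun p n => LinearMap.exists_rightInverse_of_surjective (componentMap F G p n)
    (LinearMap.range_eq_top.mpr (componentMap_surjective F G p n))
  refine ⟨DirectSum.toModule ℂ (ℤ × ℤ) N fun i => (T i.1 i.2).comp (s i.1 i.2), fun p n x => ?_⟩
  refine (DirectSum.toModule_lof ℂ (p, n) _).trans ?_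
  rw [LinearMap.comp_apply, ← sub_eq_zero, ← map_sub]
  apply hT
  rw [symbolMap, LinearMap.comp_apply, map_sub, ← LinearMap.comp_apply (componentMap F G p n), hs,
    LinearMap.id_apply, sub_self, map_zero]

theorem exists_lift₂ {N : Type u} [AddCommGroup N] [Module ℂ N]
    (T : ∀ p n q m, ↥(F p ⊓ G n) →ₗ[ℂ] ↥(F q ⊓ G m) →ₗ[ℂ] N)
    (hT : ∀ p n q m x, symbolMap F G p n x = 0 → T p n q m x = 0)
    (hT' : ∀ p n q m y, symbolMap F G q m y = 0 → (T p n q m).flip y = 0) :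
    ∃ f : GrGr F G →ₗ[ℂ] GrGr F G →ₗ[ℂ] N,
      ∀ p n q m x y, f (symbolMap F G p n x) (symbolMap F G q m y) = T p n q m x y := by
  -- The second variable is descended first, with values in maps on F_p ∩ G_n; flipping makes the
  -- first variable accessible to the same lemma.
  choose L hL using fun p n => exists_lift (N := ↥(F p ⊓ G n) →ₗ[ℂ] N)
    (fun q m => (T p n q m).flip) (fun q m y hy => hT' p n q m y hy)
  obtain ⟨f, hf⟩ := exists_lift (N := GrGr F G →ₗ[ℂ] N) (fun p n => (L p n).flip)
    (fun p n x hx => by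
      refine LinearMap.ext fun z => ?_
      induction z using piece_induction with
      | h q m z hz =>
        obtain ⟨y, hF, hG, rfl⟩ := exists_symbol hz
        have h := hL p n q m ⟨y, hF, hG⟩
        rw [symbolMap_apply] at h
        rw [LinearMap.flip_apply, h, LinearMap.flip_apply, hT p n q m x hx]
        rfl
      | hadd y z hy hz => rw [map_add, hy, hz, map_add])
  refine ⟨f, fun p n q m x y => ?_⟩
  rw [hf, LinearMap.flip_apply, hL]
  rfl

/-- A linear map of filtration degree `(a, b)` induces a map of the doubly graded spaces. -/
theorem exists_gradedMap (D : M →ₗ[ℂ] M) (a b : ℤ) (hF : ∀ p, ∀ x ∈ F p, D x ∈ F (p + a))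
    (hG : ∀ n, ∀ x ∈ G n, D x ∈ G (n + b)) :
    ∃ f : GrGr F G →ₗ[ℂ] GrGr F G, ∀ p n x hxF hxG, f (GrGr.symbol F G p n x hxF hxG)
      = GrGr.symbol F G (p + a) (n + b) (D x) (hF p x hxF) (hG n x hxG) := by
  let R (p n : ℤ) : ↥(F p ⊓ G n) →ₗ[ℂ] ↥(F (p + a) ⊓ G (n + b)) :=
    D.restrict fun x hx => ⟨hF p x hx.1, hG n x hx.2⟩
  obtain ⟨f, hf⟩ := exists_lift (F := F) (G := G)
    (fun p n => (symbolMap F G (p + a) (n + b)).comp (R p n)) (fun p n x hx => by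
      obtain ⟨y, hy, h⟩ := symbolMap_eq_zero.mp hx
      refine symbolMap_eq_zero.mpr ⟨D y, ⟨hF p y hy.1, ?_⟩, ?_⟩
      · rw [add_sub_right_comm]
        exact hG _ y hy.2
      · have h := hF _ _ h
        rw [map_sub, ← add_sub_right_comm] at h
        exact h)
  exact ⟨f, fun p n x hxF hxG => hf p n ⟨x, hxF, hxG⟩⟩

/-- A bilinear map of filtration degree `(a, b)` induces a map of the doubly graded spaces. -/
theorem exists_gradedBilinear (B : M →ₗ[ℂ] M →ₗ[ℂ] M) (a b : ℤ)
    (hF : ∀ p q, ∀ x ∈ F p, ∀ y ∈ F q, B x y ∈ F (p + q + a))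
    (hG : ∀ n m, ∀ x ∈ G n, ∀ y ∈ G m, B x y ∈ G (n + m + b)) :
    ∃ f : GrGr F G →ₗ[ℂ] GrGr F G →ₗ[ℂ] GrGr F G, ∀ p n q m x hxF hxG y hyF hyG,
      f (GrGr.symbol F G p n x hxF hxG) (GrGr.symbol F G q m y hyF hyG)
      = GrGr.symbol F G (p + q + a) (n + m + b) (B x y) (hF p q x hxF y hyF)
        (hG n m x hxG y hyG) := by
  let R (p n q m : ℤ) : ↥(F p ⊓ G n) →ₗ[ℂ] ↥(F q ⊓ G m) →ₗ[ℂ]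
      ↥(F (p + q + a) ⊓ G (n + m + b)) :=
    LinearMap.mk₂ ℂ (fun x y => ⟨B x y, hF p q x x.2.1 y y.2.1, hG n m x x.2.2 y y.2.2⟩)
      (fun x x' y => Subtype.ext (by simp)) (fun c x y => Subtype.ext (by simp))
      (fun x y y' => Subtype.ext (by simp)) (fun c x y => Subtype.ext (by simp))
  obtain ⟨f, hf⟩ := exists_lift₂ (F := F) (G := G)
    (fun p n q m => (R p n q m).compr₂ (symbolMap F G (p + q + a) (n + m + b)))
    (fun p n q m x hx => by
      -- If x = z + (x - z) with z lower for G and x - z lower for F, then B z y and B (x - z) y are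
      -- lower for G and F respectively.
      obtain ⟨z, hz, h⟩ := symbolMap_eq_zero.mp hx
      refine LinearMap.ext fun y => symbolMap_eq_zero.mpr
        ⟨B z y, ⟨hF p q z hz.1 y y.2.1, ?_⟩, ?_⟩
      · have h := hG _ m z hz.2 y y.2.2
        rwa [show n - 1 + m + b = n + m + b - 1 by ring] at h
      · have h := hF _ q _ h y y.2.1
        rw [map_sub, show p - 1 + q + a = p + q + a - 1 by ring] at h
        exact h)
    (fun p n q m y hy => by
      obtain ⟨z, hz, h⟩ := symbolMap_eq_zero.mp hy
      refine LinearMap.ext fun x => symbolMap_eq_zero.mpr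
        ⟨B x z, ⟨hF p q x x.2.1 z hz.1, ?_⟩, ?_⟩
      · have h := hG n _ x x.2.2 z hz.2
        rwa [show n + (m - 1) + b = n + m + b - 1 by ring] at h
      · have h := hF p _ x x.2.1 _ h
        rw [map_sub, show p + (q - 1) + a = p + q + a - 1 by ring] at h
        exact h)
  exact ⟨f, fun p n q m x hxF hxG y hyF hyG => hf p n q m ⟨x, hxF, hxG⟩ ⟨y, hyF, hyG⟩⟩

variable (F G)

/-- The canonical map that exchanges the two filtrations. -/
theorem exists_swap (G_mono : ∀ n, G (n - 1) ≤ G n) : ∃ f : GrGr F G →ₗ[ℂ] GrGr G F, ∀ p n x hF hG,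
    f (GrGr.symbol F G p n x hF hG) = GrGr.symbol G F n p x hG hF := by
  let R (p n : ℤ) : ↥(F p ⊓ G n) →ₗ[ℂ] ↥(G n ⊓ F p) :=
    LinearMap.id.restrict fun x hx => ⟨hx.2, hx.1⟩
  obtain ⟨f, hf⟩ := exists_lift (F := F) (G := G)
    (fun p n => (symbolMap G F n p).comp (R p n)) (fun p n x hx => by
      obtain ⟨y, hy, h⟩ := symbolMap_eq_zero.mp hx
      -- The decomposition x = y + (x - y) witnesses vanishing in the other order once its two parts
      -- are exchanged.
      exact symbolMap_eq_zero.mpr ⟨x - y, ⟨sub_mem x.2.2 (G_mono n hy.2), h⟩, by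
        change (x : M) - (x - y) ∈ G (n - 1)
        rw [sub_sub_cancel]
        exact hy.2⟩)
  exact ⟨f, fun p n x hF hG => hf p n ⟨x, hF, hG⟩⟩

end GrGr

/-! ### The Poisson algebra of a filtered superalgebra -/

theorem sgn_eq_or (p : ℤ) : sgn p = 1 ∨ sgn p = -1 :=
  (Int.even_or_odd p).imp sgn_of_even sgn_of_odd

theorem sgn_sub_two (p : ℤ) : sgn (p + -2) = sgn p := by
  rw [sgn_add, sgn_of_even (p := -2) (by decide), mul_one]

theorem sgn_mul_add (p q r : ℤ) : sgn (p * (q + r)) = sgn (p * q) * sgn (p * r) := by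
  rw [mul_add, sgn_add]

theorem sgn_add_mul (p q r : ℤ) : sgn ((p + q) * r) = sgn (p * r) * sgn (q * r) := by
  rw [add_mul, sgn_add]

theorem sgn_mul_neg_two (p : ℤ) : sgn (p * -2) = 1 := sgn_of_even ⟨-p, by ring⟩

theorem sgn_neg_two_mul (p : ℤ) : sgn (-2 * p) = 1 := sgn_of_even ⟨-p, by ring⟩

namespace FilteredSuperalgebra

variable {A : Type u} [AddCommGroup A] [Module ℂ A] {F W : ℤ → Submodule ℂ A}
  (S : FilteredSuperalgebra F W)

noncomputable def comm : A →ₗ[ℂ] A →ₗ[ℂ] A := superComm S.mul S.par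

theorem comm_mem_F {p q : ℤ} {x y : A} (hx : x ∈ F p) (hy : y ∈ F q) :
    S.comm x y ∈ F (p + q + -2) := S.comm_F p q x hx y hy

theorem comm_mem_W {k l : ℤ} {x y : A} (hx : x ∈ W k) (hy : y ∈ W l) :
    S.comm x y ∈ W (k + l + -2) := S.comm_W k l x hx y hy

theorem par_comm (x y : A) : S.par (S.comm x y) = S.comm (S.par x) (S.par y) := by
  simp only [comm, superComm_apply, map_sub, map_add, map_smul, S.par_mul]

theorem par_comm_of_par {p q : ℤ} {x y : A} (hx : S.par x = sgn p • x) (hy : S.par y = sgn q • y) :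
    S.par (S.comm x y) = sgn (p + q) • S.comm x y := by
  rw [par_comm, hx, hy, map_smul, map_smul, LinearMap.smul_apply, smul_smul, sgn_add, mul_comm]

theorem par_mul_of_par {p q : ℤ} {x y : A} (hx : S.par x = sgn p • x) (hy : S.par y = sgn q • y) :
    S.par (S.mul x y) = sgn (p + q) • S.mul x y := by
  rw [S.par_mul, hx, hy, map_smul, map_smul, LinearMap.smul_apply, smul_smul, sgn_add, mul_comm]

theorem par_d_of_par {p : ℤ} {x : A} (hx : S.par x = sgn p • x) :
    S.par (S.d x) = sgn (p + 1) • S.d x := by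
  rw [S.par_d, hx, map_smul, sgn_add, sgn_of_odd odd_one, mul_neg_one, neg_smul]

theorem comm_skew {p q : ℤ} {x y : A} (hx : S.par x = sgn p • x) (hy : S.par y = sgn q • y) :
    S.comm x y = (-sgn (p * q)) • S.comm y x := by
  rw [comm, superComm_of_par hx hy, superComm_of_par hy hx, mul_comm q p]
  rcases sgn_eq_or (p * q) with h | h <;> rw [h] <;> module

theorem comm_jacobi {p q r : ℤ} {x y z : A} (hx : S.par x = sgn p • x) (hy : S.par y = sgn q • y)
    (hz : S.par z = sgn r • z) :
    S.comm x (S.comm y z)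
      = (1 : ℂ) • S.comm (S.comm x y) z + sgn (p * q) • S.comm y (S.comm x z) := by
  have h₁ := S.par_comm_of_par hx hy
  have h₂ := S.par_comm_of_par hy hz
  have h₃ := S.par_comm_of_par hx hz
  rw [comm] at *
  rw [superComm_of_par hx h₂, superComm_of_par h₁ hz, superComm_of_par hy h₃,
    superComm_of_par hx hy, superComm_of_par hy hz, superComm_of_par hx hz]
  simp only [map_sub, map_smul, LinearMap.sub_apply, LinearMap.smul_apply, S.mul_assoc,
    sgn_mul_add, sgn_add_mul, mul_comm q p]
  rcases sgn_eq_or (p * q) with h | h <;> rcases sgn_eq_or (p * r) with h' | h' <;>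
    rcases sgn_eq_or (q * r) with h'' | h'' <;> rw [h, h', h''] <;> module

theorem comm_mul {p q r : ℤ} {x y z : A} (hx : S.par x = sgn p • x) (hy : S.par y = sgn q • y)
    (hz : S.par z = sgn r • z) :
    S.comm x (S.mul y z)
      = (1 : ℂ) • S.mul (S.comm x y) z + sgn (p * q) • S.mul y (S.comm x z) := by
  rw [comm, superComm_of_par hx (S.par_mul_of_par hy hz), superComm_of_par hx hy,
    superComm_of_par hx hz]
  simp only [map_sub, map_smul, LinearMap.sub_apply, LinearMap.smul_apply, S.mul_assoc,
    sgn_mul_add]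
  rcases sgn_eq_or (p * q) with h | h <;> rcases sgn_eq_or (p * r) with h' | h' <;>
    rw [h, h'] <;> module

theorem d_comm {p q : ℤ} {x y : A} (hx : S.par x = sgn p • x) (hy : S.par y = sgn q • y) :
    S.d (S.comm x y) = (1 : ℂ) • S.comm (S.d x) y + sgn p • S.comm x (S.d y) := by
  rw [comm, superComm_of_par hx hy, superComm_of_par (S.par_d_of_par hx) hy,
    superComm_of_par hx (S.par_d_of_par hy)]
  simp only [map_sub, map_smul, LinearMap.smul_apply, S.d_mul, hx, hy, sgn_mul_add, sgn_add_mul,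
    _root_.one_mul, _root_.mul_one]
  rcases sgn_eq_or (p * q) with h | h <;> rcases sgn_eq_or p with h' | h' <;>
    rcases sgn_eq_or q with h'' | h'' <;> rw [h, h', h''] <;> module

/-- Each class is represented by an element whose parity is that of the degree. -/
theorem exists_symbol_par {p k : ℤ} {z : GrGr F W} (hz : z ∈ GrGr.piece F W p k) :
    ∃ (x : A) (hF : x ∈ F p) (hW : x ∈ W k),
      S.par x = sgn p • x ∧ z = GrGr.symbol F W p k x hF hW := by
  obtain ⟨x, hF, hW, rfl⟩ := exists_symbol hz
  have hd := S.par_F p x hF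
  have e : (1 / 2 : ℂ) • (x + sgn p • S.par x) = x - (1 / 2 : ℂ) • (x - sgn p • S.par x) := by
    module
  refine ⟨(1 / 2 : ℂ) • (x + sgn p • S.par x), ?_, ?_, ?_, ?_⟩
  · rw [e]
    exact sub_mem hF (Submodule.smul_mem _ _ (S.F_mono p hd))
  · exact Submodule.smul_mem _ _ (add_mem hW (Submodule.smul_mem _ _ (S.par_W k x hW)))
  · simp only [map_smul, map_add, S.par_par]
    rcases sgn_eq_or p with h | h <;> rw [h] <;> module
  · refine symbol_eq_symbol ?_
    rw [e, sub_sub_cancel]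
    exact Submodule.smul_mem _ _ hd

theorem exists_grMul : ∃ f : GrGr F W →ₗ[ℂ] GrGr F W →ₗ[ℂ] GrGr F W,
    ∀ p k q l x hxF hxW y hyF hyW,
      f (GrGr.symbol F W p k x hxF hxW) (GrGr.symbol F W q l y hyF hyW)
      = GrGr.symbol F W (p + q) (k + l) (S.mul x y) (S.mul_F p q x hxF y hyF)
        (S.mul_W k l x hxW y hyW) := by
  obtain ⟨f, hf⟩ := exists_gradedBilinear S.mul 0 0
    (fun p q x hx y hy => by rw [add_zero]; exact S.mul_F p q x hx y hy)
    (fun k l x hx y hy => by rw [add_zero]; exact S.mul_W k l x hx y hy)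
  refine ⟨f, fun p k q l x hxF hxW y hyF hyW => ?_⟩
  rw [hf]
  exact symbol_congr (add_zero _).symm (add_zero _).symm rfl

noncomputable def grMul : GrGr F W →ₗ[ℂ] GrGr F W →ₗ[ℂ] GrGr F W := S.exists_grMul.choose

theorem grMul_symbol {p k q l : ℤ} {x y : A} (hxF : x ∈ F p) (hxW : x ∈ W k) (hyF : y ∈ F q)
    (hyW : y ∈ W l) :
    S.grMul (GrGr.symbol F W p k x hxF hxW) (GrGr.symbol F W q l y hyF hyW)
      = GrGr.symbol F W (p + q) (k + l) (S.mul x y) (S.mul_F p q x hxF y hyF)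
        (S.mul_W k l x hxW y hyW) :=
  S.exists_grMul.choose_spec p k q l x hxF hxW y hyF hyW

theorem exists_grD : ∃ f : GrGr F W →ₗ[ℂ] GrGr F W,
    ∀ p k x hF hW, f (GrGr.symbol F W p k x hF hW)
      = GrGr.symbol F W (p + 1) k (S.d x) (S.d_F p x hF) (S.d_W k x hW) := by
  obtain ⟨f, hf⟩ := exists_gradedMap S.d 1 0 S.d_F
    (fun k x hx => by rw [add_zero]; exact S.d_W k x hx)
  refine ⟨f, fun p k x hF hW => ?_⟩
  rw [hf]
  exact symbol_congr rfl (add_zero _).symm rfl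

noncomputable def grD : GrGr F W →ₗ[ℂ] GrGr F W := S.exists_grD.choose

theorem grD_symbol {p k : ℤ} {x : A} (hF : x ∈ F p) (hW : x ∈ W k) :
    S.grD (GrGr.symbol F W p k x hF hW)
      = GrGr.symbol F W (p + 1) k (S.d x) (S.d_F p x hF) (S.d_W k x hW) :=
  S.exists_grD.choose_spec p k x hF hW

theorem exists_grBracket : ∃ f : GrGr F W →ₗ[ℂ] GrGr F W →ₗ[ℂ] GrGr F W,
    ∀ p k q l x hxF hxW y hyF hyW,
      f (GrGr.symbol F W p k x hxF hxW) (GrGr.symbol F W q l y hyF hyW)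
      = GrGr.symbol F W (p + q + -2) (k + l + -2) (S.comm x y) (S.comm_mem_F hxF hyF)
        (S.comm_mem_W hxW hyW) :=
  exists_gradedBilinear S.comm (-2) (-2) (fun _ _ _ hx _ hy => S.comm_mem_F hx hy)
    (fun _ _ _ hx _ hy => S.comm_mem_W hx hy)

noncomputable def grBracket : GrGr F W →ₗ[ℂ] GrGr F W →ₗ[ℂ] GrGr F W := S.exists_grBracket.choose

theorem grBracket_symbol {p k q l : ℤ} {x y : A} (hxF : x ∈ F p) (hxW : x ∈ W k) (hyF : y ∈ F q)
    (hyW : y ∈ W l) :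
    S.grBracket (GrGr.symbol F W p k x hxF hxW) (GrGr.symbol F W q l y hyF hyW)
      = GrGr.symbol F W (p + q + -2) (k + l + -2) (S.comm x y) (S.comm_mem_F hxF hyF)
        (S.comm_mem_W hxW hyW) :=
  S.exists_grBracket.choose_spec p k q l x hxF hxW y hyF hyW

/-- The weight graded dg Poisson algebra associated with a filtered superalgebra. -/
noncomputable def poisson :
    WeightGradedDGPoisson (fun p k => GrGr.piece F W p k) (-2) (-2) where
  internal := isInternal_piece
  mul := S.grMul
  one := GrGr.symbol F W 0 0 S.one S.one_F S.one_W
  d := S.grD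
  bracket := S.grBracket
  one_mem := symbol_mem_piece _ _
  mul_mem p k q l x hx y hy := by
    obtain ⟨x, hxF, hxW, rfl⟩ := exists_symbol hx
    obtain ⟨y, hyF, hyW, rfl⟩ := exists_symbol hy
    rw [grMul_symbol]
    exact symbol_mem_piece _ _
  mul_assoc x y z := by
    induction x using piece_induction with
    | hadd x x' hx hx' => simp only [map_add, LinearMap.add_apply, hx, hx']
    | h p k x hx =>
      induction y using piece_induction with
      | hadd y y' hy hy' => simp only [map_add, LinearMap.add_apply, hy, hy']
      | h q l y hy =>
        induction z using piece_induction with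
        | hadd z z' hz hz' => simp only [map_add, hz, hz']
        | h r m z hz =>
          obtain ⟨x, hxF, hxW, rfl⟩ := exists_symbol hx
          obtain ⟨y, hyF, hyW, rfl⟩ := exists_symbol hy
          obtain ⟨z, hzF, hzW, rfl⟩ := exists_symbol hz
          simp only [grMul_symbol]
          exact symbol_congr (by ring) (by ring) (S.mul_assoc x y z)
  one_mul x := by
    induction x using piece_induction with
    | hadd x x' hx hx' => simp only [map_add, hx, hx']
    | h p k x hx =>
      obtain ⟨x, hxF, hxW, rfl⟩ := exists_symbol hx
      rw [grMul_symbol]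
      exact symbol_congr (by ring) (by ring) (S.one_mul x)
  mul_one x := by
    induction x using piece_induction with
    | hadd x x' hx hx' => simp only [map_add, LinearMap.add_apply, hx, hx']
    | h p k x hx =>
      obtain ⟨x, hxF, hxW, rfl⟩ := exists_symbol hx
      rw [grMul_symbol]
      exact symbol_congr (by ring) (by ring) (S.mul_one x)
  d_mem p k x hx := by
    obtain ⟨x, hxF, hxW, rfl⟩ := exists_symbol hx
    rw [grD_symbol]
    exact symbol_mem_piece _ _
  d_d x := by
    induction x using piece_induction with
    | hadd x x' hx hx' => simp only [map_add, hx, hx', add_zero]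
    | h p k x hx =>
      obtain ⟨x, hxF, hxW, rfl⟩ := exists_symbol hx
      rw [grD_symbol, grD_symbol]
      exact (symbol_smul (a := 0) rfl rfl (by rw [S.d_d, zero_smul])).trans
        (zero_smul ℂ (GrGr.symbol F W (p + 1 + 1) k 0 (zero_mem _) (zero_mem _)))
  d_mul p k x hx y := by
    induction y using piece_induction with
    | hadd y y' hy hy' =>
      simp only [map_add, hy, hy', smul_add]
      abel
    | h q l y hy =>
      -- In A the Leibniz rule involves the parity operator. For a representative of parity p it
      -- becomes the scalar (-1)^p, and the identity holds before passing to classes.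
      obtain ⟨x, hxF, hxW, hxp, rfl⟩ := S.exists_symbol_par hx
      obtain ⟨y, hyF, hyW, rfl⟩ := exists_symbol hy
      simp only [grMul_symbol, grD_symbol]
      rw [← one_smul ℂ (GrGr.symbol F W (p + 1 + q) _ _ _ _)]
      refine symbol_linear (by ring) rfl (by ring) rfl ?_
      rw [S.d_mul, hxp, map_smul, LinearMap.smul_apply, one_smul]
  bracket_mem p k q l x hx y hy := by
    obtain ⟨x, hxF, hxW, rfl⟩ := exists_symbol hx
    obtain ⟨y, hyF, hyW, rfl⟩ := exists_symbol hy
    rw [grBracket_symbol]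
    exact symbol_mem_piece _ _
  bracket_skew p k q l x hx y hy := by
    obtain ⟨x, hxF, hxW, hxp, rfl⟩ := S.exists_symbol_par hx
    obtain ⟨y, hyF, hyW, hyp, rfl⟩ := S.exists_symbol_par hy
    rw [grBracket_symbol, grBracket_symbol, ← neg_smul]
    refine symbol_smul (by ring) (by ring) ?_
    rw [S.comm_skew hxp hyp]
    simp only [sgn_add_mul, sgn_mul_add, sgn_mul_neg_two, sgn_neg_two_mul, _root_.mul_one]
  bracket_jacobi p k q l x hx y hy z := by
    induction z using piece_induction with
    | hadd z z' hz hz' =>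
      simp only [map_add, hz, hz', smul_add]
      abel
    | h r m z hz =>
      obtain ⟨x, hxF, hxW, hxp, rfl⟩ := S.exists_symbol_par hx
      obtain ⟨y, hyF, hyW, hyp, rfl⟩ := S.exists_symbol_par hy
      obtain ⟨z, hzF, hzW, hzp, rfl⟩ := S.exists_symbol_par hz
      simp only [grBracket_symbol]
      rw [← one_smul ℂ (GrGr.symbol F W (p + q + -2 + r + -2) _ _ _ _)]
      refine symbol_linear (by ring) (by ring) (by ring) (by ring) ?_
      rw [S.comm_jacobi hxp hyp hzp]
      simp only [sgn_add_mul, sgn_mul_add, sgn_mul_neg_two, sgn_neg_two_mul, _root_.mul_one]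
  bracket_mul p k q l x hx y hy z := by
    induction z using piece_induction with
    | hadd z z' hz hz' =>
      simp only [map_add, hz, hz', smul_add]
      abel
    | h r m z hz =>
      obtain ⟨x, hxF, hxW, hxp, rfl⟩ := S.exists_symbol_par hx
      obtain ⟨y, hyF, hyW, hyp, rfl⟩ := S.exists_symbol_par hy
      obtain ⟨z, hzF, hzW, hzp, rfl⟩ := S.exists_symbol_par hz
      simp only [grBracket_symbol, grMul_symbol]
      rw [← one_smul ℂ (GrGr.symbol F W (p + q + -2 + r) _ _ _ _)]
      refine symbol_linear (by ring) (by ring) (by ring) (by ring) ?_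
      rw [S.comm_mul hxp hyp hzp]
      simp only [sgn_add_mul, sgn_neg_two_mul, _root_.mul_one]
  d_bracket p k x hx y := by
    induction y using piece_induction with
    | hadd y y' hy hy' =>
      simp only [map_add, hy, hy', smul_add]
      abel
    | h q l y hy =>
      obtain ⟨x, hxF, hxW, hxp, rfl⟩ := S.exists_symbol_par hx
      obtain ⟨y, hyF, hyW, hyp, rfl⟩ := S.exists_symbol_par hy
      simp only [grBracket_symbol, grD_symbol]
      refine symbol_linear (by ring) rfl (by ring) rfl ?_
      rw [S.d_comm hxp hyp, sgn_sub_two, sgn_of_even (show Even (-2 : ℤ) by decide)]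

theorem poisson_gradedCommutative : S.poisson.GradedCommutative := by
  intro p k q l x hx y hy
  obtain ⟨x, hxF, hxW, hxp, rfl⟩ := S.exists_symbol_par hx
  obtain ⟨y, hyF, hyW, hyp, rfl⟩ := S.exists_symbol_par hy
  have h := S.comm_F p q x hxF y hyF
  rw [superComm_of_par hxp hyp] at h
  refine (S.grMul_symbol hxF hxW hyF hyW).trans (Eq.trans ?_
    (congrArg _ (S.grMul_symbol hyF hyW hxF hxW)).symm)
  have hF := S.mul_F q p y hyF x hxF
  have hW := S.mul_W l k y hyW x hxW
  rw [add_comm q p] at hF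
  rw [add_comm l k] at hW
  refine Eq.trans (symbol_eq_symbol (hF₁ := Submodule.smul_mem _ (sgn (p * q)) hF)
    (hG₁ := Submodule.smul_mem _ (sgn (p * q)) hW) ?_)
    (symbol_smul (add_comm q p) (add_comm l k) rfl)
  -- The supercommutator lies in F^(p+q-2), and membership in F^(p+q-1) is enough for the two
  -- classes to agree.
  rw [show p + q - 2 = p + q - 1 - 1 by ring] at h
  exact S.F_mono _ h

end FilteredSuperalgebra

/-! ### Transport along the isomorphism -/

section Transport

variable {B C : Type u} [AddCommGroup B] [Module ℂ B] [AddCommGroup C] [Module ℂ C]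
  {gr : ℤ → ℤ → Submodule ℂ B} {gr' : ℤ → ℤ → Submodule ℂ C} {a b : ℤ}

/-- `FilteredSuperalgebra` is not symmetric in its filtrations, since the parity is tied to F only.
The structure for the other order is therefore carried over from the first, which makes the
isomorphism automatic; it remains to match classes. -/
noncomputable def WeightGradedDGPoisson.transport (P : WeightGradedDGPoisson gr a b) (e : B ≃ₗ[ℂ] C)
    (he : ∀ p k, ∀ x ∈ gr' p k, e.symm x ∈ gr p k) (he' : ∀ p k, ∀ x ∈ gr p k, e x ∈ gr' p k)
    (internal : DirectSum.IsInternal fun i : ℤ × ℤ => gr' i.1 i.2) :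
    WeightGradedDGPoisson gr' a b where
  internal := internal
  mul := (P.mul.compl₁₂ e.symm.toLinearMap e.symm.toLinearMap).compr₂ e.toLinearMap
  one := e P.one
  d := e.toLinearMap ∘ₗ P.d ∘ₗ e.symm.toLinearMap
  bracket := (P.bracket.compl₁₂ e.symm.toLinearMap e.symm.toLinearMap).compr₂ e.toLinearMap
  one_mem := he' _ _ _ P.one_mem
  mul_mem p k q l x hx y hy := he' _ _ _ (P.mul_mem p k q l _ (he p k x hx) _ (he q l y hy))
  mul_assoc x y z := by simp [P.mul_assoc]
  one_mul x := by simp [P.one_mul]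
  mul_one x := by simp [P.mul_one]
  d_mem p k x hx := he' _ _ _ (P.d_mem p k _ (he p k x hx))
  d_d x := by simp [P.d_d]
  d_mul p k x hx y := by simp [P.d_mul p k _ (he p k x hx)]
  bracket_mem p k q l x hx y hy :=
    he' _ _ _ (P.bracket_mem p k q l _ (he p k x hx) _ (he q l y hy))
  bracket_skew p k q l x hx y hy := by
    simp [P.bracket_skew p k q l _ (he p k x hx) _ (he q l y hy)]
  bracket_jacobi p k q l x hx y hy z := by
    simp [P.bracket_jacobi p k q l _ (he p k x hx) _ (he q l y hy)]
  bracket_mul p k q l x hx y hy z := by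
    simp [P.bracket_mul p k q l _ (he p k x hx) _ (he q l y hy)]
  d_bracket p k x hx y := by simp [P.d_bracket p k _ (he p k x hx)]

variable {P : WeightGradedDGPoisson gr a b} {e : B ≃ₗ[ℂ] C}
  {he : ∀ p k, ∀ x ∈ gr' p k, e.symm x ∈ gr p k} {he' : ∀ p k, ∀ x ∈ gr p k, e x ∈ gr' p k}
  {internal : DirectSum.IsInternal fun i : ℤ × ℤ => gr' i.1 i.2}

theorem WeightGradedDGPoisson.transport_mul (x y : C) :
    (P.transport e he he' internal).mul x y = e (P.mul (e.symm x) (e.symm y)) := rfl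

theorem WeightGradedDGPoisson.transport_d (x : C) :
    (P.transport e he he' internal).d x = e (P.d (e.symm x)) := rfl

theorem WeightGradedDGPoisson.transport_bracket (x y : C) :
    (P.transport e he he' internal).bracket x y = e (P.bracket (e.symm x) (e.symm y)) := rfl

theorem WeightGradedDGPoisson.GradedCommutative.transport (h : P.GradedCommutative) :
    (P.transport e he he' internal).GradedCommutative := by
  intro p k q l x hx y hy
  rw [transport_mul, transport_mul, h p k q l _ (he p k x hx) _ (he q l y hy), map_smul]

theorem WeightGradedDGPoisson.isPoissonIso_transport :
    IsPoissonIso P (P.transport e he he' internal) e where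
  map_gr p k := le_antisymm (Submodule.map_le_iff_le_comap.mpr (he' p k)) fun x hx =>
    ⟨e.symm x, he p k x hx, e.apply_symm_apply x⟩
  map_one := rfl
  map_mul x y := by rw [transport_mul, e.symm_apply_apply, e.symm_apply_apply]
  map_d x := by rw [transport_d, e.symm_apply_apply]
  map_bracket x y := by rw [transport_bracket, e.symm_apply_apply, e.symm_apply_apply]

theorem IsInduced.transport {V : Type u} [AddCommGroup V] [Module ℂ V]
    {X : DGVertexOperatorAlgebra V} {Z : ZhuStructure X} {P : WeightGradedDGPoisson gr (-2) (-2)}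
    {σ : ∀ (p k : ℤ) (x : ZhuA X), x ∈ filF X p → x ∈ filW X k → B}
    {σ' : ∀ (p k : ℤ) (x : ZhuA X), x ∈ filF X p → x ∈ filW X k → C}
    (h : IsInduced Z σ P) (hσ : ∀ p k x hF hW, e (σ p k x hF hW) = σ' p k x hF hW) :
    IsInduced Z σ' (P.transport e he he' internal) := by
  have hσ' (p k x hF hW) : e.symm (σ' p k x hF hW) = σ p k x hF hW := by
    rw [LinearEquiv.symm_apply_eq, hσ]
  refine ⟨?_, ?_, ?_, ?_⟩
  · obtain ⟨hF, hW, h⟩ := h.one_eq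
    exact ⟨hF, hW, (congrArg e h).trans (hσ _ _ _ _ _)⟩
  · intro p k q l x y hxF hxW hyF hyW
    rw [WeightGradedDGPoisson.transport_mul, hσ', hσ', h.mul_eq, hσ]
  · intro p k x hF hW
    rw [WeightGradedDGPoisson.transport_d, hσ', h.d_eq, hσ]
  · intro p k q l u hu v hv
    obtain ⟨huF, huW, hvF, hvW, hF, hW, h⟩ := h.bracket_eq p k q l u hu v hv
    refine ⟨huF, huW, hvF, hvW, hF, hW, ?_⟩
    rw [WeightGradedDGPoisson.transport_bracket, hσ', hσ', h, hσ]

end Transport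

/-! ### The two Poisson algebras of the Zhu algebra -/

section Zhu

variable {V : Type u} [AddCommGroup V] [Module ℂ V] (X : DGVertexOperatorAlgebra V)

theorem isInduced_poisson :
    IsInduced (gr := pieceWF X) (zhuStructure X) (symbolWF X) (zhuSuperalgebra X).poisson where
  one_eq := ⟨(zhuSuperalgebra X).one_F, (zhuSuperalgebra X).one_W, rfl⟩
  mul_eq _ _ _ _ _ _ hxF hxW hyF hyW := (zhuSuperalgebra X).grMul_symbol hxF hxW hyF hyW
  d_eq _ _ _ hF hW := (zhuSuperalgebra X).grD_symbol hF hW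
  bracket_eq p k q l u hu v hv := by
    have huF : cls X u ∈ filF X p := cls_mem_zhuFil (M := X.deg) le_rfl hu.1
    have huW : cls X u ∈ filW X k := cls_mem_zhuFil (M := wtSpace X) le_rfl hu.2
    have hvF : cls X v ∈ filF X q := cls_mem_zhuFil (M := X.deg) le_rfl hv.1
    have hvW : cls X v ∈ filW X l := cls_mem_zhuFil (M := wtSpace X) le_rfl hv.2
    have e : superComm (zhuMul X) (zhuParity X) (cls X u) (cls X v)
        = zhuMul X (cls X u) (cls X v) - sgn (p * q) • zhuMul X (cls X v) (cls X u) :=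
      superComm_of_par (by rw [zhuParity_cls, parity_apply X hu.1, cls_smul])
        (by rw [zhuParity_cls, parity_apply X hv.1, cls_smul])
    have hF := (isModeGrading_deg X).superComm_mem p q _ huF _ hvF
    have hW := (isModeGrading_wtSpace X).superComm_mem k l _ huW _ hvW
    rw [e] at hF hW
    exact ⟨huF, huW, hvF, hvW, hF, hW, ((zhuSuperalgebra X).grBracket_symbol huF huW hvF hvW).trans
      (symbol_congr rfl rfl e)⟩

theorem exists_swap_equiv : ∃ e : GrGr (filF X) (filW X) ≃ₗ[ℂ] GrGr (filW X) (filF X),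
    ∀ p k x hF hW, e (symbolWF X p k x hF hW) = symbolFW X p k x hF hW := by
  obtain ⟨f, hf⟩ := exists_swap (filF X) (filW X) (zhuSuperalgebra X).W_mono
  obtain ⟨g, hg⟩ := exists_swap (filW X) (filF X) (zhuSuperalgebra X).F_mono
  refine ⟨LinearEquiv.ofLinearMap f g (LinearMap.ext fun z => ?_) (LinearMap.ext fun z => ?_), hf⟩
  · induction z using piece_induction with
    | hadd x y hx hy => rw [map_add, map_add, hx, hy]
    | h p k z hz =>
      obtain ⟨x, hF, hG, rfl⟩ := exists_symbol hz
      rw [LinearMap.comp_apply, hg, hf, LinearMap.id_apply]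
  · induction z using piece_induction with
    | hadd x y hx hy => rw [map_add, map_add, hx, hy]
    | h p k z hz =>
      obtain ⟨x, hF, hG, rfl⟩ := exists_symbol hz
      rw [LinearMap.comp_apply, hf, hg, LinearMap.id_apply]

theorem isInternal_pieceFW : DirectSum.IsInternal fun i : ℤ × ℤ => pieceFW X i.1 i.2 := by
  have h := isInternal_piece (F := filW X) (G := filF X)
  refine DirectSum.isInternal_submodule_of_iSupIndep_of_iSup_eq_top ?_ ?_
  · exact h.submodule_iSupIndep.comp (f := Prod.swap) Prod.swap_injective
  · rw [← h.submodule_iSup_eq_top]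
    exact (Equiv.prodComm ℤ ℤ).iSup_congr fun _ => rfl

end Zhu

end DGVertex

/-! ### The proposition. -/

theorem mainTheorem11 {V : Type*} [AddCommGroup V] [Module ℂ V]
    (X : DGVertex.DGVertexOperatorAlgebra V) :
    ∃ (Z : DGVertex.ZhuStructure X)
      (P : DGVertex.WeightGradedDGPoisson (DGVertex.pieceWF X) (-2) (-2))
      (Q : DGVertex.WeightGradedDGPoisson (DGVertex.pieceFW X) (-2) (-2))
      (e : DGVertex.GrGr (DGVertex.filF X) (DGVertex.filW X) ≃ₗ[ℂ]
        DGVertex.GrGr (DGVertex.filW X) (DGVertex.filF X)),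
      DGVertex.IsInduced Z (DGVertex.symbolWF X) P ∧
      DGVertex.IsInduced Z (DGVertex.symbolFW X) Q ∧
      P.GradedCommutative ∧
      Q.GradedCommutative ∧
      (∀ (p k : ℤ) (x : DGVertex.ZhuA X)
        (hF : x ∈ DGVertex.filF X p) (hW : x ∈ DGVertex.filW X k),
        e (DGVertex.symbolWF X p k x hF hW) = DGVertex.symbolFW X p k x hF hW) ∧
      DGVertex.IsPoissonIso P Q e := by
  obtain ⟨e, he⟩ := DGVertex.exists_swap_equiv X
  have hmap : ∀ p k, ∀ x ∈ DGVertex.pieceWF X p k, e x ∈ DGVertex.pieceFW X p k := by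
    intro p k x hx
    obtain ⟨x, hF, hW, rfl⟩ := DGVertex.exists_symbol hx
    exact (he p k x hF hW).symm ▸ DGVertex.symbol_mem_piece hW hF
  have hmap' : ∀ p k, ∀ x ∈ DGVertex.pieceFW X p k, e.symm x ∈ DGVertex.pieceWF X p k := by
    intro p k x hx
    obtain ⟨x, hW, hF, rfl⟩ := DGVertex.exists_symbol hx
    have h := (LinearEquiv.symm_apply_eq e).mpr (he p k x hF hW).symm
    exact h.symm ▸ DGVertex.symbol_mem_piece hF hW
  obtain ⟨P, hP, hc⟩ : ∃ P : DGVertex.WeightGradedDGPoisson (DGVertex.pieceWF X) (-2) (-2),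
      DGVertex.IsInduced (DGVertex.zhuStructure X) (DGVertex.symbolWF X) P ∧
        P.GradedCommutative :=
    ⟨_, DGVertex.isInduced_poisson X, (DGVertex.zhuSuperalgebra X).poisson_gradedCommutative⟩
  exact ⟨DGVertex.zhuStructure X, P,
    P.transport e hmap' hmap (DGVertex.isInternal_pieceFW X), e, hP, hP.transport he, hc,
    hc.transport, he, DGVertex.WeightGradedDGPoisson.isPoissonIso_transport⟩
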